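/- For $Q\ge 1$ let $\mathfrak F_Q=\{a/q: 1\le a\le q\le Q,\ \gcd(a,q)=1\}$ be the Farey fractions of order $Q$, and call a fraction (in lowest terms) even or odd according to the parity of its denominator. A pair $(\gamma',\gamma'')$ of consecutive elements of the increasing sequence of even fractions in $\mathfrak F_Q$, with denominators $q',q''$, is of type $\mathtt T(r)$ if exactly $r$ odd fractions of $\mathfrak F_Q$ lie between $\gamma'$ and $\gamma''$. For $(x_0,y_0)\in\mathbb R^2$ and $\eta>0$ let $\Box_\eta=(x_0-\eta,x_0+\eta)\times(y_0-\eta,y_0+\eta)$, and put $$g_r(x_0,y_0)=\lim_{\eta\to0^+}\frac1{4\eta^2}\lim_{Q\to\infty}\frac{\#\{(\gamma',\gamma'')\text{ of type }\mathtt T(r):\ (q'/Q,q''/Q)\in\Box_\eta\}}{\#\{(\gamma',\gamma'')\text{ consecutive even fractions in }\mathfrak F_Q\}}.$$ Let $\mathcal T=\{(x,y): 0<x,y\le1,\ x+y>1\}$, $\mathcal T_k=\{(x,y)\in\mathcal T:\ \lfloor (1+x)/y\rfloor=k\}$ and $T(x,y)=\big(y,\lfloor\frac{1+x}{y}\rfloor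 y-x\big)$. For an $r$-tuple $\mathbf k=(k_1,\dots,k_r)$ of positive integers let $\mathcal T_{\mathbf k}=\mathcal T_{k_1}\cap T^{-1}\mathcal T_{k_2}\cap\dots\cap T^{-r+1}\mathcal T_{k_r}$, a (possibly empty) convex polygon, and let $V(\mathcal T_{\mathbf k})$ be its set of vertices. The tuple is admissible if all its components are even, except that for $r\ge2$ the first and the last one are odd. Put $p_0=1$, $p_1(k_1)=k_1$, $p_r(k_1,\dots,k_r)=k_rp_{r-1}(k_1,\dots,k_{r-1})-p_{r-2}(k_1,\dots,k_{r-2})$, and, writing $p=p_r(\mathbf k)$ and $p'=p_{r-1}(k_2,\dots,k_r)$, let $$\mathcal P_{\mathbf k}(\eta)=\{(x,y):\ (x,\ p\,y-p'x)\in\Box_\eta\},\qquad C_{\mathbf k}=\Big(x_0,\ \frac{p'}{p}x_0+\frac1p y_0\Big).$$ Theorem. Let $r\ge1$ be an integer and $(x_0,y_0)\in[0,1]^2$, where $(x_0,y_0)\ne(1,1)$ if $r\in\{2,3\}$. For each admissible $r$-tuple $\mathbf k$ such that $C_{\mathbf k}$ is a vertex $V$ of $\mathcal T_{\mathbf k}$,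 the ratio $\mathrm{Area}(\mathcal T_{\mathbf k}\cap\mathcal P_{\mathbf k}(\eta))/\eta^2$ has a value $\alpha_{\mathbf k}(V)$ which does not depend on $\eta$ for small $\eta>0$. The limits that define $g_r(x_0,y_0)$ exist (the inner one for all small $\eta$; the outer one in $[0,\infty]$), and $$g_r(x_0,y_0)=\sum_{C_{\mathbf k}\in\overset{\circ}{\mathcal T_{\mathbf k}}}\frac{2}{p_r(\mathbf k)}+\sum_{C_{\mathbf k}\in\partial\mathcal T_{\mathbf k}\setminus V(\mathcal T_{\mathbf k})}\frac1{p_r(\mathbf k)}+\frac12\sum_{C_{\mathbf k}=V\in V(\mathcal T_{\mathbf k})}\alpha_{\mathbf k}(V),$$ where $\mathbf k$ runs over the admissible $r$-tuples. If $(x_0,y_0)\ne(1,1)$, only finitely many $\mathbf k$ occur in the three sums, so that $g_r(x_0,y_0)$ is finite. -/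

import Mathlib

open MeasureTheory Filter Topology
open scoped ENNReal

noncomputable section

namespace EvenFarey

/-! ### Farey fractions and the local density of pairs of a given type -/

/-- The Farey fractions of order `Q`: the reduced fractions `a / q` with `1 ≤ a ≤ q ≤ Q`. -/
def farey (Q : ℕ) : Set ℚ := {x | 0 < x ∧ x ≤ 1 ∧ x.den ≤ Q}

/-- The Farey fractions of order `Q` with even denominator. -/
def fareyEven (Q : ℕ) : Set ℚ := {x | x ∈ farey Q ∧ Even x.den}

/-- The pairs `(γ', γ'')` of consecutive elements, in increasing order, of `fareyEven Q`. -/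
def evenPairs (Q : ℕ) : Set (ℚ × ℚ) :=
  {p | p.1 ∈ fareyEven Q ∧ p.2 ∈ fareyEven Q ∧ p.1 < p.2 ∧
    ∀ x ∈ fareyEven Q, ¬ (p.1 < x ∧ x < p.2)}

/-- The pairs of consecutive even Farey fractions that are of type `T(r)`: exactly `r`
fractions of `farey Q` with odd denominator lie strictly between the two. -/
def pairsOfType (r Q : ℕ) : Set (ℚ × ℚ) :=
  {p | p ∈ evenPairs Q ∧ {x | x ∈ farey Q ∧ Odd x.den ∧ p.1 < x ∧ x < p.2}.ncard = r}

/-- The open square of side `2 η` centred at `(x₀, y₀)`, with sides parallel to the axes. -/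
def square (x₀ y₀ η : ℝ) : Set (ℝ × ℝ) :=
  Set.Ioo (x₀ - η) (x₀ + η) ×ˢ Set.Ioo (y₀ - η) (y₀ + η)

/-- Among all pairs of consecutive even Farey fractions of order `Q`, the proportion of those
which are of type `T(r)` and whose point `(q'/Q, q''/Q)` lies in the square. -/
def proportion (r : ℕ) (x₀ y₀ η : ℝ) (Q : ℕ) : ℝ :=
  ({p | p ∈ pairsOfType r Q ∧
      ((p.1.den : ℝ) / (Q : ℝ), (p.2.den : ℝ) / (Q : ℝ)) ∈ square x₀ y₀ η}.ncard : ℝ) /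
    ((evenPairs Q).ncard : ℝ)

/-- The local density `g_r(x₀, y₀)` of the points `(q'/Q, q''/Q)` of type `T(r)` exists and has
the value `g` (possibly `∞`): for all small squares the proportion of these points in the square
has a limit `L η` as `Q → ∞`, and this limit divided by the area of the square tends to `g`
as the area tends to `0`. -/
def HasLocalDensity (r : ℕ) (x₀ y₀ : ℝ) (g : ℝ≥0∞) : Prop :=
  ∃ L : ℝ → ℝ,
    (∀ᶠ η in 𝓝[>] (0 : ℝ), Tendsto (proportion r x₀ y₀ η) atTop (𝓝 (L η))) ∧
    Tendsto (fun η : ℝ => ENNReal.ofReal (L η / (4 * η ^ 2))) (𝓝[>] (0 : ℝ)) (𝓝 g)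

/-! ### The polygons `T_k` -/

/-- The polygon `T_k` of the points of the Farey triangle where `⌊(1 + x) / y⌋ = k`. -/
def basicPolygon (k : ℕ) : Set (ℝ × ℝ) :=
  {v | 0 < v.1 ∧ v.1 ≤ 1 ∧ 0 < v.2 ∧ v.2 ≤ 1 ∧ 1 < v.1 + v.2 ∧
    (k : ℝ) * v.2 ≤ 1 + v.1 ∧ 1 + v.1 < ((k : ℝ) + 1) * v.2}

/-- The map `T(x, y) = (y, ⌊(1 + x) / y⌋ y - x)`, which maps the Farey triangle to itself. -/
def fareyMap (v : ℝ × ℝ) : ℝ × ℝ := (v.2, (⌊(1 + v.1) / v.2⌋ : ℝ) * v.2 - v.1)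

/-- The polygon `T_k = T_{k₁} ∩ T⁻¹ T_{k₂} ∩ ⋯ ∩ T^{-(r-1)} T_{k_r}` of an `r`-tuple `k`
(`r ≥ 1`); the components are numbered from `0` here. -/
def polygon {r : ℕ} (k : Fin r → ℕ) : Set (ℝ × ℝ) :=
  ⋂ i : Fin r, (fareyMap^[(i : ℕ)]) ⁻¹' basicPolygon (k i)

/-- The vertices of the convex polygon `T_k` (those of its closure, as `T_k` contains only a part
of its boundary). -/
def vertices {r : ℕ} (k : Fin r → ℕ) : Set (ℝ × ℝ) :=
  Set.extremePoints ℝ (closure (polygon k))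

/-- The admissible `r`-tuples of positive integers: for `r ≥ 2` the first and the last component
are odd; all other components are even. -/
def Admissible {r : ℕ} (k : Fin r → ℕ) : Prop :=
  ∀ i : Fin r, 0 < k i ∧
    (Odd (k i) ↔ 2 ≤ r ∧ ((i : ℕ) = 0 ∨ (i : ℕ) + 1 = r))

/-! ### The index, the parallelogram and its centre -/

/-- The polynomials `p_r(k₁, …, k_r)`: `p_0 = 1`, `p_1(k₁) = k₁` and
`p_r(k₁, …, k_r) = k_r p_{r-1}(k₁, …, k_{r-1}) - p_{r-2}(k₁, …, k_{r-2})`. -/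
def index : (r : ℕ) → (Fin r → ℕ) → ℤ
  | 0, _ => 1
  | 1, k => (k 0 : ℤ)
  | (r + 2), k =>
      (k (Fin.last (r + 1)) : ℤ) * index (r + 1) (fun i => k i.castSucc)
        - index r (fun i => k i.castSucc.castSucc)

/-- `p_{r-1}(k₂, …, k_r)`, for an `r`-tuple `k` with `r ≥ 1`. -/
def indexTail {r : ℕ} (k : Fin r → ℕ) : ℤ :=
  index (r - 1) (fun i => k ⟨(i : ℕ) + 1, by have := i.isLt; omega⟩)

/-- The parallelogram of the points `(x, y)` for which `(x, p_r(k) y - p_{r-1}(k₂, …, k_r) x)`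
lies in the square of side `2 η` centred at `(x₀, y₀)`. -/
def parallelogram {r : ℕ} (k : Fin r → ℕ) (x₀ y₀ η : ℝ) : Set (ℝ × ℝ) :=
  {v | (v.1, (index r k : ℝ) * v.2 - (indexTail k : ℝ) * v.1) ∈ square x₀ y₀ η}

/-- The centre `C_k(r)` of the parallelogram. -/
def center {r : ℕ} (k : Fin r → ℕ) (x₀ y₀ : ℝ) : ℝ × ℝ :=
  (x₀, (indexTail k : ℝ) / (index r k : ℝ) * x₀ + 1 / (index r k : ℝ) * y₀)

/-- The area of the intersection of `T_k` with the parallelogram. -/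
def overlapArea {r : ℕ} (k : Fin r → ℕ) (x₀ y₀ η : ℝ) : ℝ :=
  (volume (polygon k ∩ parallelogram k x₀ y₀ η)).toReal

/-- The number `α_k(V)`, where `V = C_k(r)`: the value, for small `η`, of the area of the
intersection of `T_k` with the parallelogram, divided by `η ^ 2`. -/
def alpha {r : ℕ} (k : Fin r → ℕ) (x₀ y₀ : ℝ) : ℝ :=
  limUnder (𝓝[>] (0 : ℝ)) (fun η : ℝ => overlapArea k x₀ y₀ η / η ^ 2)

/-! ### The right-hand side of the formula -/

/-- The admissible `r`-tuples whose centre is interior to `T_k`. -/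
def interiorTuples (r : ℕ) (x₀ y₀ : ℝ) : Set (Fin r → ℕ) :=
  {k | Admissible k ∧ center k x₀ y₀ ∈ interior (polygon k)}

/-- The admissible `r`-tuples whose centre is on the boundary of `T_k`, but is not a vertex. -/
def edgeTuples (r : ℕ) (x₀ y₀ : ℝ) : Set (Fin r → ℕ) :=
  {k | Admissible k ∧ center k x₀ y₀ ∈ frontier (polygon k) \ vertices k}

/-- The admissible `r`-tuples whose centre is a vertex of `T_k`. -/
def vertexTuples (r : ℕ) (x₀ y₀ : ℝ) : Set (Fin r → ℕ) :=
  {k | Admissible k ∧ center k x₀ y₀ ∈ vertices k}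

/-- The sum of the terms `2 / p_r(k)`, `1 / p_r(k)` and `α_k(V) / 2`. All terms are nonnegative,
and the sum is taken in `[0, ∞]`. -/
def densityFormula (r : ℕ) (x₀ y₀ : ℝ) : ℝ≥0∞ :=
  (∑' k : interiorTuples r x₀ y₀, ENNReal.ofReal (2 / (index r k.1 : ℝ))) +
  (∑' k : edgeTuples r x₀ y₀, ENNReal.ofReal (1 / (index r k.1 : ℝ))) +
  (∑' k : vertexTuples r x₀ y₀, ENNReal.ofReal (alpha k.1 x₀ y₀ / 2))

end EvenFarey

end

noncomputable section

namespace EvenFarey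

open scoped Pointwise

/-! ### The coordinates of the orbit as linear forms -/

/-! For successive fractions of denominator at most `Q`, the points (q/Q, q'/Q) formed by
neighbouring denominators are an orbit of `fareyMap`, and the integers (q + q'')/q' name the
polygons that the orbit visits (`fareyMap_denPoint`, `denPoint_mem_basicPolygon`). An even fraction
starts a pair of type T(r) when the next r denominators are odd and the one after them is even. By
the recurrence for the denominators modulo 2, this is admissibility of the tuple of quotients
(`parityChain_iff`). On T_k the orbit is linear and its coordinate x_{r+1} is p y - p' x
(`form_last`), so the condition on the two end denominators says that the starting point lies in
P_k(η). Up to one pair, lost where the chain passes 1, the numerator therefore counts coprime (q,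
q') with q even and (q, q')/Q in the disjoint union `region` of the sets T_k ∩ P_k(η)
(`ncard_pairsOfType_bounds`).

For a set with null frontier, lattice point counting and Möbius inversion give c · Area · Q² such
points asymptotically, with a nonzero constant c (`tendsto_evenCoprimePoints`). Dividing by the same
count for the whole Farey triangle, of area 1/2, gives the inner limit 2 · Area(`region`)
(`tendsto_proportion`).

The outer limit is local geometry. Near a point of its closure a polygon agrees with a cone, so
Area(T_k ∩ P_k(η)) is exactly η² `localArea` for small η (`eventually_volume_eq`). The value is 4/p
at an interior point, half of that on an edge because the parallelogram is centrally symmetric, and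
α at a vertex. Multiplying by 2/(4η²) gives the three kinds of terms.

It remains to interchange this limit with the sum over k. A large component of k makes some orbit
coordinate small. Admissibility then forces r ≤ 3 and both x_0 and x_{r+1} close to 1
(`Admissible.extreme_coordinates`). Hence away from (1, 1), or for r ≥ 4, only finitely many tuples
matter. For r = 1 at (1, 1) both sides are infinite, by comparison with the harmonic series. -/

/-- The linear forms `x₀ = x`, `x₁ = y`, `x_{j+2} = K_j x_{j+1} - x_j`. -/
def form (K : ℕ → ℕ) : ℕ → (ℝ × ℝ →L[ℝ] ℝ)
  | 0 => ContinuousLinearMap.fst ℝ ℝ ℝ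
  | 1 => ContinuousLinearMap.snd ℝ ℝ ℝ
  | (j + 2) => (K j : ℝ) • form K (j + 1) - form K j

@[simp] lemma form_zero (K : ℕ → ℕ) (v : ℝ × ℝ) : form K 0 v = v.1 := rfl

@[simp] lemma form_one (K : ℕ → ℕ) (v : ℝ × ℝ) : form K 1 v = v.2 := rfl

lemma form_add_two (K : ℕ → ℕ) (j : ℕ) (v : ℝ × ℝ) :
    form K (j + 2) v = K j * form K (j + 1) v - form K j v := by
  simp [form]

/-- The extension by zero of a tuple to a sequence. -/
def extend {r : ℕ} (k : Fin r → ℕ) (j : ℕ) : ℕ := if h : j < r then k ⟨j, h⟩ else 0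

lemma extend_of_lt {r : ℕ} (k : Fin r → ℕ) {j : ℕ} (h : j < r) : extend k j = k ⟨j, h⟩ :=
  dif_pos h

lemma extend_val {r : ℕ} (k : Fin r → ℕ) (i : Fin r) : extend k i = k i :=
  extend_of_lt k i.isLt

/-- The continuants `p_j(K_0, …, K_{j-1})` of a sequence. -/
def continuant (K : ℕ → ℕ) : ℕ → ℤ
  | 0 => 1
  | 1 => K 0
  | (j + 2) => K (j + 1) * continuant K (j + 1) - continuant K j

lemma index_eq_continuant (K : ℕ → ℕ) :
    ∀ r : ℕ, index r (fun i : Fin r => K i) = continuant K r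
  | 0 => rfl
  | 1 => rfl
  | (r + 2) => by
    have h₁ := index_eq_continuant K (r + 1)
    have h₀ := index_eq_continuant K r
    simp only [index, continuant, ← h₁, ← h₀]
    rfl

lemma index_eq {r : ℕ} (k : Fin r → ℕ) : index r k = continuant (extend k) r := by
  rw [← index_eq_continuant]
  congr 1
  funext i
  exact (extend_val k i).symm

lemma indexTail_eq {r : ℕ} (k : Fin r → ℕ) :
    indexTail k = continuant (fun j => extend k (j + 1)) (r - 1) := by
  rw [← index_eq_continuant, indexTail]
  congr 1
  funext i
  exact (extend_of_lt k _).symm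

/-- Both continuants on the right satisfy, in j, the recurrence that defines the forms, so it
suffices to compare two initial values. -/
lemma form_add_two_eq (K : ℕ → ℕ) (v : ℝ × ℝ) : ∀ j : ℕ,
    form K (j + 2) v = continuant K (j + 1) * v.2 - continuant (fun i => K (i + 1)) j * v.1
  | 0 => by simp [form_add_two, continuant]
  | 1 => by
    simp [form_add_two, continuant]
    ring
  | (j + 2) => by
    have h₁ := form_add_two_eq K v (j + 1)
    have h₀ := form_add_two_eq K v j
    rw [form_add_two, h₁, h₀]
    simp only [continuant]
    push_cast
    ring

/-- This explains the parallelogram: its second condition constrains the last coordinate of the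
orbit, which for Farey fractions is q''/Q. -/
lemma form_last {r : ℕ} (hr : 1 ≤ r) (k : Fin r → ℕ) (v : ℝ × ℝ) :
    form (extend k) (r + 1) v = index r k * v.2 - indexTail k * v.1 := by
  obtain ⟨s, rfl⟩ : ∃ s, r = s + 1 := ⟨r - 1, by omega⟩
  rw [form_add_two_eq, index_eq, indexTail_eq]
  simp

/-- The discrete Wronskian of two solutions of the same second order recurrence is constant; its
value is read off at j = 0. -/
lemma continuant_mul_form_sub (K : ℕ → ℕ) (v : ℝ × ℝ) (j : ℕ) :
    continuant K (j + 1) * form K (j + 1) v - continuant K j * form K (j + 2) v = v.1 := by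
  induction j with
  | zero => simp [continuant, form_add_two]
  | succ j ih =>
    rw [form_add_two K (j + 1), ← ih]
    simp only [continuant]
    push_cast
    ring

/-! ### Polygons as systems of linear inequalities -/

lemma mem_basicPolygon_iff (m : ℕ) (v : ℝ × ℝ) :
    v ∈ basicPolygon m ↔ v.1 ≤ 1 ∧ v.2 ≤ 1 ∧ (m : ℝ) * v.2 - v.1 ≤ 1 ∧ 1 < v.1 + v.2 ∧
      1 < v.2 + ((m : ℝ) * v.2 - v.1) := by
  simp only [basicPolygon, Set.mem_ofPred_eq]
  constructor
  · rintro ⟨h1, h2, h3, h4, h5, h6, h7⟩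
    refine ⟨h2, h4, ?_, h5, ?_⟩ <;> linarith
  · rintro ⟨h1, h2, h3, h4, h5⟩
    refine ⟨?_, ?_, ?_, ?_, ?_, ?_, ?_⟩ <;> linarith

lemma floor_of_mem_basicPolygon {m : ℕ} {v : ℝ × ℝ} (h : v ∈ basicPolygon m) :
    ⌊(1 + v.1) / v.2⌋ = (m : ℤ) := by
  obtain ⟨-, -, h3, -, -, h6, h7⟩ := h
  rw [Int.floor_eq_iff]
  constructor
  · rw [le_div_iff₀ h3]; exact_mod_cast h6
  · rw [div_lt_iff₀ h3]; exact_mod_cast h7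

lemma fareyMap_of_mem {m : ℕ} {v : ℝ × ℝ} (h : v ∈ basicPolygon m) :
    fareyMap v = (v.2, (m : ℝ) * v.2 - v.1) := by
  simp [fareyMap, floor_of_mem_basicPolygon h]

lemma iterate_fareyMap {r : ℕ} {K : ℕ → ℕ} {v : ℝ × ℝ}
    (h : ∀ j < r, fareyMap^[j] v ∈ basicPolygon (K j)) :
    ∀ j ≤ r, fareyMap^[j] v = (form K j v, form K (j + 1) v) := by
  intro j hj
  induction j with
  | zero => simp
  | succ j ih =>
    have := h j (by omega)
    rw [Function.iterate_succ_apply', fareyMap_of_mem this, ih (by omega), form_add_two]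

lemma mem_polygon_iff_iterate {r : ℕ} (k : Fin r → ℕ) (v : ℝ × ℝ) :
    v ∈ polygon k ↔ ∀ j < r, fareyMap^[j] v ∈ basicPolygon (extend k j) := by
  simp only [polygon, Set.mem_iInter, Set.mem_preimage]
  constructor
  · intro h j hj
    rw [extend_of_lt k hj]
    exact h ⟨j, hj⟩
  · intro h i
    rw [← extend_val k i]
    exact h i i.isLt

/-- Consecutive conditions overlap, so T_k reduces to x_j ≤ 1 and x_j + x_{j+1} > 1; positivity of
the coordinates is a consequence. In the converse direction the iterates of the map equal the linear
forms only once the earlier memberships are known, hence the induction on the length of the prefix.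
-/
lemma mem_polygon_iff {r : ℕ} (hr : 1 ≤ r) (k : Fin r → ℕ) (v : ℝ × ℝ) :
    v ∈ polygon k ↔ (∀ j < r + 2, form (extend k) j v ≤ 1) ∧
      ∀ j < r + 1, 1 < form (extend k) j v + form (extend k) (j + 1) v := by
  rw [mem_polygon_iff_iterate]
  constructor
  · intro h
    have key : ∀ j < r, (form (extend k) j v, form (extend k) (j + 1) v) ∈
        basicPolygon (extend k j) := fun j hj => by
      rw [← iterate_fareyMap h j hj.le]; exact h j hj
    simp only [mem_basicPolygon_iff, ← form_add_two] at key
    constructor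
    · intro j hj
      rcases j with _ | _ | j
      · exact (key 0 (by omega)).1
      · exact (key 0 (by omega)).2.1
      · exact (key j (by omega)).2.2.1
    · intro j hj
      rcases j with _ | j
      · exact (key 0 (by omega)).2.2.2.1
      · exact (key j (by omega)).2.2.2.2
  · rintro ⟨h1, h2⟩
    have key : ∀ j ≤ r, ∀ i < j, fareyMap^[i] v ∈ basicPolygon (extend k i) := by
      intro j
      induction j with
      | zero => intro _ i hi; omega
      | succ j ih =>
        intro hj i hi
        rcases Nat.lt_succ_iff_lt_or_eq.mp hi with hi | rfl
        · exact ih (by omega) i hi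
        · rw [iterate_fareyMap (ih (by omega)) i le_rfl, mem_basicPolygon_iff]
          simp only [← form_add_two]
          exact ⟨h1 _ (by omega), h1 _ (by omega), h1 _ (by omega), h2 _ (by omega),
            h2 _ (by omega)⟩
    exact key r le_rfl

lemma form_pos {r : ℕ} (hr : 1 ≤ r) {k : Fin r → ℕ} {v : ℝ × ℝ} (h : v ∈ polygon k) {j : ℕ}
    (hj : j < r + 2) : 0 < form (extend k) j v := by
  obtain ⟨h1, h2⟩ := (mem_polygon_iff hr k v).mp h
  rcases j with _ | j
  · have := h1 1 (by omega)
    have := h2 0 (by omega)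
    simp only [zero_add] at *
    linarith
  · have := h1 j (by omega)
    have := h2 j (by omega)
    linarith

/-- By the Wronskian identity p_{j+1} x_{j+1} = x_0 + p_j x_{j+2}, and all orbit coordinates are
positive, so positivity passes from p_j to p_{j+1}. -/
lemma index_pos {r : ℕ} (hr : 1 ≤ r) {k : Fin r → ℕ} (h : (polygon k).Nonempty) :
    0 < index r k := by
  obtain ⟨v, hv⟩ := h
  rw [index_eq]
  have key : ∀ j ≤ r, 0 < continuant (extend k) j := by
    intro j hj
    induction j with
    | zero => simp [continuant]
    | succ j ih =>
      have h0 := continuant_mul_form_sub (extend k) v j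
      have h1 : (0 : ℝ) < continuant (extend k) j := by exact_mod_cast ih (by omega)
      have h2 := form_pos hr hv (j := j + 1) (by omega)
      have h3 := form_pos hr hv (j := j + 2) (by omega)
      have h4 : 0 < v.1 := form_pos hr hv (j := 0) (by omega)
      have h5 : (0 : ℝ) < continuant (extend k) (j + 1) * form (extend k) (j + 1) v := by
        nlinarith [mul_pos h1 h3]
      exact_mod_cast (pos_iff_pos_of_mul_pos h5).mpr h2
  exact key r le_rfl

lemma polygon_disjoint {r : ℕ} {k l : Fin r → ℕ} (h : k ≠ l) :
    Disjoint (polygon k) (polygon l) := by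
  rw [Set.disjoint_left]
  intro v hk hl
  apply h
  funext i
  simp only [polygon, Set.mem_iInter, Set.mem_preimage] at hk hl
  have := (floor_of_mem_basicPolygon (hk i)).symm.trans (floor_of_mem_basicPolygon (hl i))
  exact_mod_cast this

/-! ### Local structure of a polyhedron `f ≤ 1 < g` at a point of its closure -/

section Polyhedron

variable {E ι κ : Type*} [NormedAddCommGroup E] [NormedSpace ℝ E]
  (f : ι → E →L[ℝ] ℝ) (g : κ → E →L[ℝ] ℝ)

/-- The solutions of the inequalities `f i ≤ 1` and `1 < g j`. -/
def polyhedron : Set E := {v | (∀ i, f i v ≤ 1) ∧ ∀ j, 1 < g j v}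

/-- The solutions of the linearized inequalities that are active at `C`. -/
def localCone (C : E) : Set E :=
  {u | (∀ i, f i C = 1 → f i u ≤ 0) ∧ ∀ j, g j C = 1 → 0 < g j u}

variable {f g}

lemma closure_polyhedron_subset :
    closure (polyhedron f g) ⊆ {v | (∀ i, f i v ≤ 1) ∧ ∀ j, 1 ≤ g j v} := by
  apply closure_minimal
  · exact fun v hv => ⟨hv.1, fun j => (hv.2 j).le⟩
  · have : {v : E | (∀ i, f i v ≤ 1) ∧ ∀ j, 1 ≤ g j v} =
        (⋂ i, {v | f i v ≤ 1}) ∩ ⋂ j, {v | 1 ≤ g j v} := by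
      ext v; simp
    rw [this]
    exact (isClosed_iInter fun i => isClosed_le (f i).continuous continuous_const).inter
      (isClosed_iInter fun j => isClosed_le continuous_const (g j).continuous)

lemma convex_polyhedron : Convex ℝ (polyhedron f g) := by
  have : polyhedron f g = (⋂ i, {v | f i v ≤ 1}) ∩ ⋂ j, {v | 1 < g j v} := by
    ext v; simp [polyhedron]
  rw [this]
  exact (convex_iInter fun i => convex_halfSpace_le (f i).isLinear 1).inter
    (convex_iInter fun j => convex_halfSpace_gt (g j).isLinear 1)

lemma measurableSet_polyhedron [Countable ι] [Countable κ] [MeasurableSpace E] [BorelSpace E] :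
    MeasurableSet (polyhedron f g) := by
  have : polyhedron f g = (⋂ i, {v | f i v ≤ 1}) ∩ ⋂ j, {v | 1 < g j v} := by
    ext v; simp [polyhedron]
  rw [this]
  exact (MeasurableSet.iInter fun i =>
      (isClosed_le (f i).continuous continuous_const).measurableSet).inter
    (MeasurableSet.iInter fun j =>
      (isOpen_lt continuous_const (g j).continuous).measurableSet)

variable [Finite κ]

/-- Scaling a solution by t slightly below 1 makes every upper inequality strict, because the bound
1 is positive, and preserves the finitely many open lower ones. So a nonempty polyhedron of this
shape has interior points. -/
lemma exists_strict (h : (polyhedron f g).Nonempty) :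
    ∃ v : E, (∀ i, f i v < 1) ∧ ∀ j, 1 < g j v := by
  obtain ⟨v, h1, h2⟩ := h
  have hj : ∀ᶠ t in 𝓝[<] (1 : ℝ), ∀ j, 1 < g j (t • v) := by
    rw [eventually_all]
    intro j
    have : Tendsto (fun t : ℝ => g j (t • v)) (𝓝[<] 1) (𝓝 (g j ((1 : ℝ) • v))) :=
      (Continuous.tendsto (by fun_prop) 1).mono_left nhdsWithin_le_nhds
    rw [one_smul] at this
    exact this.eventually_const_lt (h2 j)
  have h0 : ∀ᶠ t in 𝓝[<] (1 : ℝ), 0 < t :=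
    nhdsWithin_le_nhds (lt_mem_nhds one_pos)
  obtain ⟨t, ⟨htj, ht0⟩, ht1⟩ := ((hj.and h0).and self_mem_nhdsWithin).exists
  refine ⟨t • v, fun i => ?_, htj⟩
  have ht1 : t < 1 := ht1
  simp only [map_smul, smul_eq_mul]
  nlinarith [h1 i]

variable [Finite ι]

lemma isOpen_strict : IsOpen {v : E | (∀ i, f i v < 1) ∧ ∀ j, 1 < g j v} := by
  have : {v : E | (∀ i, f i v < 1) ∧ ∀ j, 1 < g j v} =
      (⋂ i, {v | f i v < 1}) ∩ ⋂ j, {v | 1 < g j v} := by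
    ext v; simp
  rw [this]
  exact (isOpen_iInter_of_finite fun i => isOpen_lt (f i).continuous continuous_const).inter
    (isOpen_iInter_of_finite fun j => isOpen_lt continuous_const (g j).continuous)

lemma mem_interior_polyhedron {v : E} (h1 : ∀ i, f i v < 1) (h2 : ∀ j, 1 < g j v) :
    v ∈ interior (polyhedron f g) :=
  mem_interior.mpr ⟨_, fun _ hw => ⟨fun i => (hw.1 i).le, hw.2⟩, isOpen_strict, h1, h2⟩

/-- Inactive constraints have slack at C, which a displacement of size O(η) cannot use up; active
ones become homogeneous, so η cancels. Boundedness of B and finiteness of the families make one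
threshold for η serve for all. -/
lemma eventually_add_smul_mem_iff {C : E} (hC : C ∈ closure (polyhedron f g)) {B : Set E}
    (hB : Bornology.IsBounded B) :
    ∀ᶠ η in 𝓝[>] (0 : ℝ), ∀ u ∈ B, C + η • u ∈ polyhedron f g ↔ u ∈ localCone f g C := by
  obtain ⟨hf, hg⟩ := closure_polyhedron_subset hC
  obtain ⟨R, hR⟩ := hB.exists_norm_le
  have small : ∀ (l : E →L[ℝ] ℝ) (δ : ℝ), 0 < δ →
      ∀ᶠ η in 𝓝[>] (0 : ℝ), ∀ u ∈ B, |η * l u| < δ := by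
    intro l δ hδ
    have : Tendsto (fun η : ℝ => η * (‖l‖ * R)) (𝓝[>] 0) (𝓝 (0 * (‖l‖ * R))) :=
      (Continuous.tendsto (by fun_prop) 0).mono_left nhdsWithin_le_nhds
    rw [zero_mul] at this
    filter_upwards [this.eventually_lt_const hδ, self_mem_nhdsWithin] with η h1 h2 u hu
    have h2 : 0 < η := h2
    have h3 : |l u| ≤ ‖l‖ * R :=
      (l.le_opNorm u).trans (mul_le_mul_of_nonneg_left (hR u hu) (norm_nonneg l))
    rw [abs_mul, abs_of_pos h2]
    exact (mul_le_mul_of_nonneg_left h3 h2.le).trans_lt h1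
  have ef : ∀ᶠ η in 𝓝[>] (0 : ℝ), ∀ i, ∀ u ∈ B,
      (f i (C + η • u) ≤ 1 ↔ (f i C = 1 → f i u ≤ 0)) := by
    rw [eventually_all]
    intro i
    rcases (hf i).lt_or_eq with h | h
    · filter_upwards [small (f i) (1 - f i C) (by linarith)] with η hη u hu
      have := abs_lt.mp (hη u hu)
      simp only [map_add, map_smul, smul_eq_mul, h.ne, false_imp_iff, iff_true]
      linarith
    · filter_upwards [self_mem_nhdsWithin] with η hη u _
      have hη : 0 < η := hη
      simp only [map_add, map_smul, smul_eq_mul, h, true_imp_iff]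
      rw [add_le_iff_nonpos_right, mul_nonpos_iff_pos_imp_nonpos]
      constructor
      · exact fun h => h.1 hη
      · exact fun h => ⟨fun _ => h, fun h' => hη.le⟩
  have eg : ∀ᶠ η in 𝓝[>] (0 : ℝ), ∀ j, ∀ u ∈ B,
      (1 < g j (C + η • u) ↔ (g j C = 1 → 0 < g j u)) := by
    rw [eventually_all]
    intro j
    rcases (hg j).lt_or_eq with h | h
    · filter_upwards [small (g j) (g j C - 1) (by linarith)] with η hη u hu
      have := abs_lt.mp (hη u hu)
      simp only [map_add, map_smul, smul_eq_mul, h.ne', false_imp_iff, iff_true]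
      linarith
    · filter_upwards [self_mem_nhdsWithin] with η hη u _
      have hη : 0 < η := hη
      simp only [map_add, map_smul, smul_eq_mul, ← h, true_imp_iff]
      rw [lt_add_iff_pos_right, mul_pos_iff_of_pos_left hη]
  filter_upwards [ef, eg] with η h1 h2 u hu
  exact and_congr (forall_congr' fun i => h1 i u hu) (forall_congr' fun j => h2 j u hu)

lemma exists_active {C : E} (hC : C ∈ frontier (polyhedron f g)) :
    (∃ i, f i C = 1) ∨ ∃ j, g j C = 1 := by
  by_contra! h
  obtain ⟨hf, hg⟩ := closure_polyhedron_subset hC.1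
  exact hC.2 (mem_interior_polyhedron (fun i => (hf i).lt_of_ne (h.1 i))
    fun j => (hg j).lt_of_ne' (h.2 j))

/-- At a boundary point which is not a vertex of a plane polyhedron the local cone is
a half-plane, up to the bounding line. -/
lemma exists_halfPlane {f : ι → ℝ × ℝ →L[ℝ] ℝ} {g : κ → ℝ × ℝ →L[ℝ] ℝ} {C : ℝ × ℝ}
    (hC : C ∈ frontier (polyhedron f g))
    (hV : C ∉ Set.extremePoints ℝ (closure (polyhedron f g))) :
    ∃ t : ℝ × ℝ →L[ℝ] ℝ, t ≠ 0 ∧ {u | 0 < t u} ⊆ localCone f g C ∧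
      localCone f g C ⊆ {u | 0 ≤ t u} := by
  have hC' : C ∈ closure (polyhedron f g) := hC.1
  obtain ⟨v₀, hv1, hv2⟩ := exists_strict (closure_nonempty_iff.mp ⟨C, hC'⟩)
  rw [mem_extremePoints_iff_left] at hV
  push Not at hV
  obtain ⟨a, ha, b, hb, hab, hne⟩ := hV hC'
  obtain ⟨s, t, hs, ht, hst, rfl⟩ := hab
  obtain ⟨haf, hag⟩ := closure_polyhedron_subset ha
  obtain ⟨hbf, hbg⟩ := closure_polyhedron_subset hb
  set C := s • a + t • b with hCdef
  have hd : b - a ≠ 0 := by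
    intro h
    have : b = a := sub_eq_zero.mp h
    apply hne
    rw [hCdef, this, ← add_smul, hst, one_smul]
  -- An active form equals its extreme value 1 at a point inside the segment from a to b, hence at
  -- both ends; it vanishes on the direction d of the segment.
  have act_f : ∀ i, f i C = 1 → f i (b - a) = 0 := by
    intro i hi
    rw [hCdef, map_add, map_smul, map_smul, smul_eq_mul, smul_eq_mul] at hi
    rw [map_sub]
    have h1 := haf i
    have h2 := hbf i
    have h3 : s * (1 - f i a) = 0 := by
      nlinarith [mul_nonneg hs.le (sub_nonneg.mpr h1),
        mul_nonneg ht.le (sub_nonneg.mpr h2)]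
    have h4 : t * (1 - f i b) = 0 := by
      nlinarith [mul_nonneg hs.le (sub_nonneg.mpr h1),
        mul_nonneg ht.le (sub_nonneg.mpr h2)]
    have h5 := (mul_eq_zero.mp h3).resolve_left hs.ne'
    have h6 := (mul_eq_zero.mp h4).resolve_left ht.ne'
    linarith
  have act_g : ∀ j, g j C = 1 → g j (b - a) = 0 := by
    intro i hi
    rw [hCdef, map_add, map_smul, map_smul, smul_eq_mul, smul_eq_mul] at hi
    rw [map_sub]
    have h1 := hag i
    have h2 := hbg i
    have h3 : s * (g i a - 1) = 0 := by
      nlinarith [mul_nonneg hs.le (sub_nonneg.mpr h1),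
        mul_nonneg ht.le (sub_nonneg.mpr h2)]
    have h4 : t * (g i b - 1) = 0 := by
      nlinarith [mul_nonneg hs.le (sub_nonneg.mpr h1),
        mul_nonneg ht.le (sub_nonneg.mpr h2)]
    have h5 := (mul_eq_zero.mp h3).resolve_left hs.ne'
    have h6 := (mul_eq_zero.mp h4).resolve_left ht.ne'
    linarith
  set d := b - a with hddef
  let w : ℝ × ℝ →L[ℝ] ℝ :=
    d.1 • ContinuousLinearMap.snd ℝ ℝ ℝ - d.2 • ContinuousLinearMap.fst ℝ ℝ ℝ
  have hw : ∀ u, w u = d.1 * u.2 - d.2 * u.1 := fun u => by simp [w]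
  have hd2 : d.1 ^ 2 + d.2 ^ 2 ≠ 0 := by
    intro h
    apply hd
    have h1 : d.1 = 0 := by nlinarith [sq_nonneg d.1, sq_nonneg d.2]
    have h2 : d.2 = 0 := by nlinarith [sq_nonneg d.1, sq_nonneg d.2]
    exact Prod.ext h1 h2
  have prop : ∀ l : ℝ × ℝ →L[ℝ] ℝ, l d = 0 → ∃ c : ℝ, ∀ u, l u = c * w u := by
    intro l hl
    have hl' : ∀ u : ℝ × ℝ, l u = u.1 * l (1, 0) + u.2 * l (0, 1) := by
      intro u
      have : u = u.1 • ((1 : ℝ), (0 : ℝ)) + u.2 • ((0 : ℝ), (1 : ℝ)) := by ext <;> simp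
      conv_lhs => rw [this]
      rw [map_add, map_smul, map_smul, smul_eq_mul, smul_eq_mul]
    rw [hl' d] at hl
    -- The factor is found by evaluating `l` and `w` at (-d.2, d.1), which is orthogonal to d.
    refine ⟨(d.1 * l (0, 1) - d.2 * l (1, 0)) / (d.1 ^ 2 + d.2 ^ 2), fun u => ?_⟩
    rw [hl' u, hw, div_mul_eq_mul_div, eq_div_iff hd2]
    linear_combination (d.1 * u.1 + d.2 * u.2) * hl
  -- All active forms are multiples of `w`, and pointing towards a strictly interior point fixes all
  -- their signs at once. Thus they all describe the same half-plane, bounded by the line through d.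
  set u₀ := v₀ - C with hu₀
  have u₀f : ∀ i, f i C = 1 → f i u₀ < 0 := fun i hi => by
    rw [hu₀, map_sub, hi]; linarith [hv1 i]
  have u₀g : ∀ j, g j C = 1 → 0 < g j u₀ := fun j hj => by
    rw [hu₀, map_sub, hj]; linarith [hv2 j]
  have hwu : w u₀ ≠ 0 := by
    intro h0
    rcases exists_active hC with ⟨i, hi⟩ | ⟨j, hj⟩
    · obtain ⟨c, hc⟩ := prop (f i) (act_f i hi)
      have := u₀f i hi
      rw [hc, h0, mul_zero] at this
      exact lt_irrefl _ this
    · obtain ⟨c, hc⟩ := prop (g j) (act_g j hj)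
      have := u₀g j hj
      rw [hc, h0, mul_zero] at this
      exact lt_irrefl _ this
  have scale : ∀ l : ℝ × ℝ →L[ℝ] ℝ, l d = 0 → ∀ u, l u = l u₀ * ((w u₀)⁻¹ * w u) := by
    intro l hl u
    obtain ⟨c, hc⟩ := prop l hl
    rw [hc u, hc u₀]
    field_simp
  refine ⟨(w u₀)⁻¹ • w, ?_, ?_, ?_⟩
  · intro h
    have := congrArg (fun l : ℝ × ℝ →L[ℝ] ℝ => l u₀) h
    simp [hwu] at this
  · intro u hu
    have hu : 0 < (w u₀)⁻¹ * w u := hu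
    refine ⟨fun i hi => ?_, fun j hj => ?_⟩
    · rw [scale (f i) (act_f i hi) u]
      exact mul_nonpos_of_nonpos_of_nonneg (u₀f i hi).le hu.le
    · rw [scale (g j) (act_g j hj) u]
      exact mul_pos (u₀g j hj) hu
  · intro u hu
    change 0 ≤ (w u₀)⁻¹ * w u
    rcases exists_active hC with ⟨i, hi⟩ | ⟨j, hj⟩
    · have := hu.1 i hi
      rw [scale (f i) (act_f i hi) u] at this
      exact nonneg_of_mul_nonpos_right this (u₀f i hi)
    · have := hu.2 j hj
      rw [scale (g j) (act_g j hj) u] at this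
      exact (pos_iff_pos_of_mul_pos this).mp (u₀g j hj) |>.le

end Polyhedron

lemma volume_setOf_eq_zero {t : ℝ × ℝ →L[ℝ] ℝ} (ht : t ≠ 0) :
    volume {u : ℝ × ℝ | t u = 0} = 0 := by
  have := Measure.addHaar_submodule (volume : Measure (ℝ × ℝ)) (LinearMap.ker t.toLinearMap) (by
    intro h
    apply ht
    ext1 <;> ext <;> simpa using (LinearMap.ker_eq_top.mp h ▸ rfl : t.toLinearMap _ = 0))
  convert this using 2
  ext u
  exact Iff.rfl

/-- A half-plane through the origin contains half of a centrally symmetric set. -/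
lemma volume_halfPlane_inter {t : ℝ × ℝ →L[ℝ] ℝ} (ht : t ≠ 0) {X B : Set (ℝ × ℝ)}
    (hB : ∀ u, -u ∈ B ↔ u ∈ B) (h1 : {u | 0 < t u} ⊆ X) (h2 : X ⊆ {u | 0 ≤ t u}) :
    2 * volume (X ∩ B) = volume B := by
  have hz := volume_setOf_eq_zero ht
  have hm : MeasurableSet {u : ℝ × ℝ | 0 < t u} :=
    (isOpen_lt continuous_const t.continuous).measurableSet
  have e1 : volume (X ∩ B) = volume (B ∩ {u | 0 < t u}) := by
    apply le_antisymm
    · calc volume (X ∩ B) ≤ volume ((B ∩ {u | 0 < t u}) ∪ {u | t u = 0}) := by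
            apply measure_mono
            rintro u ⟨hu, hb⟩
            rcases (show 0 ≤ t u from h2 hu).lt_or_eq with h | h
            · exact Or.inl ⟨hb, h⟩
            · exact Or.inr h.symm
        _ ≤ _ := (measure_union_le _ _).trans (by rw [hz, add_zero])
    · exact measure_mono fun u hu => ⟨h1 hu.2, hu.1⟩
  have e2 : volume (B \ {u | 0 < t u}) = volume (B ∩ {u | 0 < t u}) := by
    have : volume (B ∩ {u | 0 < t u}) = volume (B ∩ {u | t u < 0}) := by
      rw [← Measure.measure_neg volume (B ∩ {u | 0 < t u})]
      congr 1
      ext u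
      simp [hB]
    rw [this]
    apply le_antisymm
    · calc volume (B \ {u | 0 < t u}) ≤ volume ((B ∩ {u | t u < 0}) ∪ {u | t u = 0}) := by
            apply measure_mono
            rintro u ⟨hb, hu⟩
            rcases (show t u ≤ 0 from not_lt.mp hu).lt_or_eq with h | h
            · exact Or.inl ⟨hb, h⟩
            · exact Or.inr h
        _ ≤ _ := (measure_union_le _ _).trans (by rw [hz, add_zero])
    · exact measure_mono fun u hu => ⟨hu.1, not_lt.mpr (show t u < 0 from hu.2).le⟩
  rw [← measure_inter_add_sdiff B hm, e1, e2, two_mul]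

/-! ### The local area of `T_k` along the parallelogram -/

/-- The map (x, y) ↦ (x, p y - q x) has determinant p. -/
lemma volume_shear_preimage {p : ℝ} (hp : 0 < p) (q : ℝ) (S T : Set ℝ) :
    volume {u : ℝ × ℝ | u.1 ∈ S ∧ p * u.2 - q * u.1 ∈ T} =
      ENNReal.ofReal p⁻¹ * (volume S * volume T) := by
  let A : ℝ × ℝ →ₗ[ℝ] ℝ × ℝ :=
    (LinearMap.fst ℝ ℝ ℝ).prod (p • LinearMap.snd ℝ ℝ ℝ - q • LinearMap.fst ℝ ℝ ℝ)
  have hdet : LinearMap.det A = p := by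
    rw [← LinearMap.det_toMatrix (Module.Basis.finTwoProd ℝ), Matrix.det_fin_two]
    simp [A, LinearMap.toMatrix_apply]
  have h := Measure.addHaar_preimage_linearMap (volume : Measure (ℝ × ℝ)) (f := A)
    (by rw [hdet]; exact hp.ne') (S ×ˢ T)
  rw [hdet, abs_of_pos (inv_pos.mpr hp), Measure.volume_eq_prod, Measure.prod_prod] at h
  exact h

section

variable {r : ℕ} (k : Fin r → ℕ)

/-- The forms bounded above by `1` on `T_k`. -/
def upperForms (i : Fin (r + 2)) : ℝ × ℝ →L[ℝ] ℝ := form (extend k) i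

/-- The forms bounded below by `1` on `T_k`. -/
def lowerForms (j : Fin (r + 1)) : ℝ × ℝ →L[ℝ] ℝ := form (extend k) j + form (extend k) (j + 1)

lemma polygon_eq (hr : 1 ≤ r) : polygon k = polyhedron (upperForms k) (lowerForms k) := by
  ext v
  rw [mem_polygon_iff hr]
  exact and_congr ⟨fun h i => h i i.isLt, fun h i hi => h ⟨i, hi⟩⟩
    ⟨fun h i => h i i.isLt, fun h i hi => h ⟨i, hi⟩⟩

/-- The parallelogram with `η = 1`, translated to the origin. -/
def unitParallelogram : Set (ℝ × ℝ) :=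
  {u | u.1 ∈ Set.Ioo (-1 : ℝ) 1 ∧ (index r k : ℝ) * u.2 - indexTail k * u.1 ∈ Set.Ioo (-1 : ℝ) 1}

lemma neg_mem_unitParallelogram (u : ℝ × ℝ) :
    -u ∈ unitParallelogram k ↔ u ∈ unitParallelogram k := by
  simp only [unitParallelogram, Set.mem_ofPred_eq, Set.mem_Ioo, Prod.fst_neg, Prod.snd_neg]
  constructor <;> rintro ⟨⟨h1, h2⟩, h3, h4⟩ <;> refine ⟨⟨?_, ?_⟩, ?_, ?_⟩ <;> linarith

variable {k}

lemma volume_unitParallelogram (hp : 0 < index r k) :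
    volume (unitParallelogram k) = ENNReal.ofReal (4 / index r k) := by
  have hp' : (0 : ℝ) < index r k := by exact_mod_cast hp
  rw [unitParallelogram, volume_shear_preimage hp', Real.volume_Ioo,
    ← ENNReal.ofReal_mul (by norm_num), ← ENNReal.ofReal_mul (by positivity)]
  congr 1
  ring

lemma isBounded_unitParallelogram (hp : 0 < index r k) :
    Bornology.IsBounded (unitParallelogram k) := by
  have hp' : (0 : ℝ) < index r k := by exact_mod_cast hp
  set q : ℝ := (indexTail k : ℝ) with hq
  refine (Metric.isBounded_Icc ((-1 : ℝ), -((1 + |q|) / (index r k : ℝ)))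
    ((1 : ℝ), (1 + |q|) / (index r k : ℝ))).subset ?_
  rintro ⟨a, b⟩ ⟨⟨h1, h2⟩, h3, h4⟩
  simp only at h1 h2 h3 h4
  have h5 : |q * a| ≤ |q| := by
    rw [abs_mul]
    exact mul_le_of_le_one_right (abs_nonneg q) (abs_le.mpr ⟨h1.le, h2.le⟩)
  have h6 := abs_le.mp h5
  refine ⟨⟨h1.le, ?_⟩, h2.le, ?_⟩
  · change -_ ≤ b
    rw [neg_le, le_div_iff₀ hp']
    linarith
  · change b ≤ _
    rw [le_div_iff₀ hp']
    linarith

lemma add_smul_mem_parallelogram (hp : 0 < index r k) (x₀ y₀ : ℝ) {η : ℝ} (hη : 0 < η)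
    (u : ℝ × ℝ) :
    center k x₀ y₀ + η • u ∈ parallelogram k x₀ y₀ η ↔ u ∈ unitParallelogram k := by
  have hp' : (index r k : ℝ) ≠ 0 := by exact_mod_cast hp.ne'
  have e : (index r k : ℝ) * (center k x₀ y₀ + η • u).2 - indexTail k * (center k x₀ y₀ + η • u).1
      = y₀ + η * (index r k * u.2 - indexTail k * u.1) := by
    simp only [center, Prod.snd_add, Prod.fst_add, Prod.smul_fst, Prod.smul_snd, smul_eq_mul]
    field_simp
    ring
  have e' : (center k x₀ y₀ + η • u).1 = x₀ + η * u.1 := rfl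
  have key : ∀ c t : ℝ, c + η * t ∈ Set.Ioo (c - η) (c + η) ↔ t ∈ Set.Ioo (-1 : ℝ) 1 := by
    intro c t
    simp only [Set.mem_Ioo]
    constructor
    · rintro ⟨h1, h2⟩
      constructor <;> nlinarith
    · rintro ⟨h1, h2⟩
      constructor <;> nlinarith
  rw [parallelogram, Set.mem_ofPred_eq, square, Set.mem_prod, e, e', key, key]
  exact Iff.rfl

variable (k) in
/-- The limit of `Area(T_k ∩ P_k(η)) / η ^ 2` as `η → 0`. -/
def localArea (x₀ y₀ : ℝ) : ℝ≥0∞ :=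
  open Classical in
  if center k x₀ y₀ ∈ closure (polygon k) then
    volume (localCone (upperForms k) (lowerForms k) (center k x₀ y₀) ∩ unitParallelogram k)
  else 0

/-- In the coordinate u with v = C + η u the parallelogram becomes independent of η, and areas in
the plane scale by η². -/
lemma volume_inter_parallelogram (hp : 0 < index r k) (x₀ y₀ : ℝ) {η : ℝ} (hη : 0 < η)
    {S X : Set (ℝ × ℝ)} (h : ∀ u ∈ unitParallelogram k, center k x₀ y₀ + η • u ∈ S ↔ u ∈ X) :
    volume (S ∩ parallelogram k x₀ y₀ η) =
      ENNReal.ofReal (η ^ 2) * volume (X ∩ unitParallelogram k) := by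
  have e : S ∩ parallelogram k x₀ y₀ η =
      (fun v => -center k x₀ y₀ + v) ⁻¹' (η • (X ∩ unitParallelogram k)) := by
    ext v
    obtain ⟨u, rfl⟩ : ∃ u, v = center k x₀ y₀ + η • u :=
      ⟨η⁻¹ • (v - center k x₀ y₀), by rw [smul_inv_smul₀ hη.ne']; abel⟩
    rw [Set.mem_preimage, neg_add_cancel_left, Set.smul_mem_smul_set_iff₀ hη.ne',
      Set.mem_inter_iff, add_smul_mem_parallelogram hp x₀ y₀ hη, Set.mem_inter_iff]
    exact and_congr_left fun hu => h u hu
  rw [e, measure_preimage_add, Measure.addHaar_smul]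
  simp

/-- The area of `T_k ∩ P_k(η)` is proportional to `η ^ 2` for small `η`. -/
lemma eventually_volume_eq (hr : 1 ≤ r) (k : Fin r → ℕ) (x₀ y₀ : ℝ) :
    ∀ᶠ η in 𝓝[>] (0 : ℝ), volume (polygon k ∩ parallelogram k x₀ y₀ η) =
      ENNReal.ofReal (η ^ 2) * localArea k x₀ y₀ := by
  -- Positivity of the index, hence a meaningful centre, is only available when T_k has a point;
  -- otherwise both sides vanish.
  rcases (polygon k).eq_empty_or_nonempty with he | hne
  · simp [localArea, he]
  have hp := index_pos hr hne
  by_cases hC : center k x₀ y₀ ∈ closure (polygon k)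
  · simp only [localArea, hC, if_true]
    rw [polygon_eq k hr] at hC ⊢
    filter_upwards [eventually_add_smul_mem_iff hC (isBounded_unitParallelogram hp),
      self_mem_nhdsWithin] with η h1 h2
    exact volume_inter_parallelogram hp x₀ y₀ h2 h1
  · simp only [localArea, hC, if_false, mul_zero]
    -- The centre has a neighbourhood disjoint from the polygon, and the parallelogram shrinks into
    -- it.
    obtain ⟨R, hR⟩ := (isBounded_unitParallelogram hp).exists_norm_le
    obtain ⟨ε, hε, hball⟩ := Metric.isOpen_iff.mp isClosed_closure.isOpen_compl _ hC
    have : Tendsto (fun η : ℝ => η * R) (𝓝[>] 0) (𝓝 (0 * R)) :=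
      (Continuous.tendsto (by fun_prop) 0).mono_left nhdsWithin_le_nhds
    rw [zero_mul] at this
    filter_upwards [this.eventually_lt_const hε, self_mem_nhdsWithin] with η h1 h2
    have h2 : 0 < η := h2
    rw [volume_inter_parallelogram hp x₀ y₀ h2 (X := ∅) fun u hu => ?_]
    · simp
    · simp only [Set.mem_empty_iff_false, iff_false]
      intro hmem
      refine hball ?_ (subset_closure hmem)
      rw [Metric.mem_ball, dist_eq_norm, add_sub_cancel_left, norm_smul, Real.norm_of_nonneg h2.le]
      exact (mul_le_mul_of_nonneg_left (hR u hu) h2.le).trans_lt h1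

lemma localArea_ne_top (hr : 1 ≤ r) (k : Fin r → ℕ) (x₀ y₀ : ℝ) : localArea k x₀ y₀ ≠ ∞ := by
  rw [localArea]
  split_ifs with h
  · have hp := index_pos hr (closure_nonempty_iff.mp ⟨_, h⟩)
    refine ne_top_of_le_ne_top ?_ (measure_mono Set.inter_subset_right)
    rw [volume_unitParallelogram hp]
    exact ENNReal.ofReal_ne_top
  · exact ENNReal.zero_ne_top

/-- For small η the whole parallelogram lies in T_k, so the cone contains the unit parallelogram. -/
lemma localArea_eq_of_interior (hr : 1 ≤ r) {x₀ y₀ : ℝ}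
    (h : center k x₀ y₀ ∈ interior (polygon k)) :
    localArea k x₀ y₀ = ENNReal.ofReal (4 / index r k) := by
  have hp := index_pos hr ⟨_, interior_subset h⟩
  have hC := subset_closure (interior_subset h)
  rw [localArea, if_pos hC, ← volume_unitParallelogram hp]
  congr 1
  rw [Set.inter_eq_right]
  intro u hu
  have hbd := isBounded_unitParallelogram hp
  have h1 := eventually_add_smul_mem_iff (by rwa [← polygon_eq k hr]) hbd
    (f := upperForms k) (g := lowerForms k) (C := center k x₀ y₀)
  have h2 : ∀ᶠ η in 𝓝[>] (0 : ℝ), center k x₀ y₀ + η • u ∈ polygon k := by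
    have : Tendsto (fun η : ℝ => center k x₀ y₀ + η • u) (𝓝[>] 0)
        (𝓝 (center k x₀ y₀ + (0 : ℝ) • u)) :=
      (Continuous.tendsto (by fun_prop) 0).mono_left nhdsWithin_le_nhds
    rw [zero_smul, add_zero] at this
    exact this.eventually (mem_interior_iff_mem_nhds.mp h)
  obtain ⟨η, h3, h4⟩ := (h1.and h2).exists
  rw [← polygon_eq k hr] at h3
  exact (h3 u hu).mp h4

/-- Here the cone is a half-plane up to a null line, and it cuts the centrally symmetric
parallelogram in half. -/
lemma localArea_eq_of_edge (hr : 1 ≤ r) {x₀ y₀ : ℝ}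
    (h : center k x₀ y₀ ∈ frontier (polygon k) \ vertices k) :
    localArea k x₀ y₀ = ENNReal.ofReal (2 / index r k) := by
  have hC : center k x₀ y₀ ∈ closure (polygon k) := h.1.1
  have hp := index_pos hr (closure_nonempty_iff.mp ⟨_, hC⟩)
  have hp' : (0 : ℝ) < index r k := by exact_mod_cast hp
  rw [localArea, if_pos hC]
  obtain ⟨h1, h2⟩ := h
  rw [vertices] at h2
  rw [polygon_eq k hr] at h1 h2
  obtain ⟨t, ht, ht1, ht2⟩ := exists_halfPlane h1 h2
  have h3 := volume_halfPlane_inter ht (neg_mem_unitParallelogram k) ht1 ht2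
  rw [volume_unitParallelogram hp, show (4 : ℝ) / index r k = 2 * (2 / index r k) by ring,
    ENNReal.ofReal_mul (by norm_num), ENNReal.ofReal_ofNat] at h3
  exact (ENNReal.mul_right_inj (by norm_num) (by norm_num)).mp h3

lemma eventually_overlapArea_eq (hr : 1 ≤ r) (k : Fin r → ℕ) (x₀ y₀ : ℝ) :
    ∀ᶠ η in 𝓝[>] (0 : ℝ), overlapArea k x₀ y₀ η = (localArea k x₀ y₀).toReal * η ^ 2 := by
  filter_upwards [eventually_volume_eq hr k x₀ y₀] with η h
  rw [overlapArea, h, ENNReal.toReal_mul, ENNReal.toReal_ofReal (sq_nonneg η), mul_comm]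

lemma alpha_eq (hr : 1 ≤ r) (k : Fin r → ℕ) (x₀ y₀ : ℝ) :
    alpha k x₀ y₀ = (localArea k x₀ y₀).toReal := by
  apply Tendsto.limUnder_eq
  apply tendsto_const_nhds.congr'
  filter_upwards [eventually_overlapArea_eq hr k x₀ y₀, self_mem_nhdsWithin] with η h1 h2
  have h2 : 0 < η := h2
  rw [h1]
  field_simp

/-- An interior point is the midpoint of a short horizontal segment inside T_k, so it is not
extreme. -/
lemma vertices_subset_frontier : vertices k ⊆ frontier (polygon k) := by
  intro C hC
  refine ⟨hC.1, fun hint => ?_⟩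
  have hlim : ∀ s : ℝ, ∀ᶠ t in 𝓝[>] (0 : ℝ), C + t • ((s : ℝ), (0 : ℝ)) ∈ polygon k := by
    intro s
    have : Tendsto (fun t : ℝ => C + t • ((s : ℝ), (0 : ℝ))) (𝓝[>] 0)
        (𝓝 (C + (0 : ℝ) • ((s : ℝ), (0 : ℝ)))) :=
      (Continuous.tendsto (by fun_prop) 0).mono_left nhdsWithin_le_nhds
    rw [zero_smul, add_zero] at this
    exact this.eventually (mem_interior_iff_mem_nhds.mp hint)
  obtain ⟨t, ⟨h1, h2⟩, h3⟩ := (((hlim 1).and (hlim (-1))).and self_mem_nhdsWithin).exists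
  have h3 : 0 < t := h3
  have := (mem_extremePoints_iff_left.mp hC).2 _ (subset_closure h1) _ (subset_closure h2)
    ⟨1 / 2, 1 / 2, by norm_num, by norm_num, by norm_num, by ext <;> simp <;> ring⟩
  have := congrArg Prod.fst this
  simp [h3.ne'] at this

/-- The three sums of the formula, put together. -/
lemma densityFormula_eq (hr : 1 ≤ r) (x₀ y₀ : ℝ) :
    densityFormula r x₀ y₀ =
      ∑' k : Fin r → ℕ, {k | Admissible k}.indicator (fun k => localArea k x₀ y₀ / 2) k := by
  have half : ∀ a : ℝ, ENNReal.ofReal (a / 2) = ENNReal.ofReal a / 2 := fun a => by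
    rw [ENNReal.ofReal_div_of_pos (by norm_num), ENNReal.ofReal_ofNat]
  rw [densityFormula,
    tsum_subtype (interiorTuples r x₀ y₀) (fun k => ENNReal.ofReal (2 / (index r k : ℝ))),
    tsum_subtype (edgeTuples r x₀ y₀) (fun k => ENNReal.ofReal (1 / (index r k : ℝ))),
    tsum_subtype (vertexTuples r x₀ y₀) (fun k => ENNReal.ofReal (alpha k x₀ y₀ / 2)),
    ← ENNReal.tsum_add, ← ENNReal.tsum_add]
  congr 1
  funext k
  by_cases hA : Admissible k
  swap
  · rw [Set.indicator_of_notMem fun h => hA h.1, Set.indicator_of_notMem fun h => hA h.1,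
      Set.indicator_of_notMem fun h => hA h.1, Set.indicator_of_notMem fun h => hA h]
    simp
  rw [Set.indicator_of_mem (show k ∈ {k | Admissible k} from hA)]
  by_cases hi : center k x₀ y₀ ∈ interior (polygon k)
  · rw [Set.indicator_of_mem (show k ∈ interiorTuples r x₀ y₀ from ⟨hA, hi⟩),
      Set.indicator_of_notMem (fun h => h.2.1.2 hi),
      Set.indicator_of_notMem (fun h => (vertices_subset_frontier h.2).2 hi),
      localArea_eq_of_interior hr hi, ← half, add_zero, add_zero]
    congr 1
    ring
  rw [Set.indicator_of_notMem (fun h => hi h.2), zero_add]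
  by_cases hv : center k x₀ y₀ ∈ vertices k
  · rw [Set.indicator_of_notMem (fun h => h.2.2 hv),
      Set.indicator_of_mem (show k ∈ vertexTuples r x₀ y₀ from ⟨hA, hv⟩), alpha_eq hr, half,
      ENNReal.ofReal_toReal (localArea_ne_top hr k x₀ y₀), zero_add]
  rw [Set.indicator_of_notMem (s := vertexTuples r x₀ y₀) (fun h => hv h.2), add_zero]
  by_cases hC : center k x₀ y₀ ∈ closure (polygon k)
  · rw [Set.indicator_of_mem (show k ∈ edgeTuples r x₀ y₀ from ⟨hA, ⟨hC, hi⟩, hv⟩),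
      localArea_eq_of_edge hr ⟨⟨hC, hi⟩, hv⟩, ← half]
    congr 1
    ring
  · rw [Set.indicator_of_notMem (fun h => hC h.2.1.1), localArea, if_neg hC]
    simp

end

/-! ### Large components of admissible tuples -/

/-- A positive component below 2 is 1, hence odd, and admissibility allows odd components only at
the two ends of a tuple of length at least 2. -/
lemma Admissible.extend_eq_one {r : ℕ} {k : Fin r → ℕ} (hk : Admissible k) {j : ℕ} (hj : j < r)
    (h2 : extend k j < 2) : extend k j = 1 ∧ 2 ≤ r ∧ (j = 0 ∨ j + 1 = r) := by
  obtain ⟨h, h'⟩ := hk ⟨j, hj⟩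
  rw [extend_of_lt k hj] at h2 ⊢
  have h1 : k ⟨j, hj⟩ = 1 := by omega
  exact ⟨h1, h'.mp (h1 ▸ odd_one)⟩

lemma lt_two_of_mul_le {n : ℕ} {x e : ℝ} (he : e < 1 / 3) (hx : 1 - e < x)
    (h : n * x ≤ 1 + e) : n < 2 := by
  by_contra! hn
  have : (2 : ℝ) ≤ n := by exact_mod_cast hn
  nlinarith

/-- If the `i`-th component of an admissible tuple is large, the coordinate `e = x_{i+1}` of
a point of `T_k` is small, and the extreme coordinates are close to `1`. -/
lemma Admissible.extreme_coordinates {r : ℕ} (hr : 1 ≤ r) {k : Fin r → ℕ} (hk : Admissible k)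
    {v : ℝ × ℝ} (hv : v ∈ polygon k) {i : ℕ} (hi : i < r)
    (he : form (extend k) (i + 1) v < 1 / 3) :
    r ≤ 3 ∧ 1 - 2 * form (extend k) (i + 1) v < v.1 ∧
      1 - 2 * form (extend k) (i + 1) v < form (extend k) (r + 1) v := by
  obtain ⟨hle, hlt⟩ := (mem_polygon_iff hr k v).mp hv
  have hpos := form_pos hr hv (j := i + 1) (by omega)
  have right : r ≤ i + 2 ∧ 1 - 2 * form (extend k) (i + 1) v < form (extend k) (r + 1) v := by
    have h1 := hlt (i + 1) (by omega)
    rcases Nat.lt_or_ge (i + 1) r with h | h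
    · have h2 := form_add_two (extend k) (i + 1) v
      have h3 := hle (i + 3) (by omega)
      obtain ⟨h4, -, h5⟩ := hk.extend_eq_one h (lt_two_of_mul_le he
        (x := form (extend k) (i + 2) v) (by linarith) (by linarith))
      obtain rfl : r = i + 2 := by omega
      refine ⟨le_rfl, ?_⟩
      rw [h4] at h2
      push_cast at h2
      linarith
    · obtain rfl : r = i + 1 := by omega
      exact ⟨by omega, by linarith⟩
  have left : i ≤ 1 ∧ 1 - 2 * form (extend k) (i + 1) v < v.1 := by
    have h1 := hlt i (by omega)
    rcases i with _ | i
    · refine ⟨by omega, ?_⟩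
      simp only [form_zero, zero_add] at h1 hpos ⊢
      linarith
    · have h2 := form_add_two (extend k) i v
      have h3 := hle i (by omega)
      obtain ⟨h4, -, h5⟩ := hk.extend_eq_one (j := i) (by omega) (lt_two_of_mul_le he
        (x := form (extend k) (i + 1) v) (by linarith) (by linarith))
      obtain rfl : i = 0 := by omega
      refine ⟨le_rfl, ?_⟩
      rw [h4] at h2
      simp only [form_zero, zero_add] at *
      push_cast at h2
      linarith
  exact ⟨by omega, left.2, right.2⟩

/-- The product is x_i + x_{i+2}, a sum of two coordinates at most 1. -/
lemma extend_mul_form_le {r : ℕ} (hr : 1 ≤ r) {k : Fin r → ℕ} {v : ℝ × ℝ} (hv : v ∈ polygon k)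
    {i : ℕ} (hi : i < r) : extend k i * form (extend k) (i + 1) v ≤ 2 := by
  obtain ⟨hle, -⟩ := (mem_polygon_iff hr k v).mp hv
  have h2 := form_add_two (extend k) i v
  linarith [hle i (by omega), hle (i + 2) (by omega)]

lemma parallelogram_mono {r : ℕ} (k : Fin r → ℕ) (x₀ y₀ : ℝ) {η η' : ℝ} (h : η ≤ η') :
    parallelogram k x₀ y₀ η ⊆ parallelogram k x₀ y₀ η' := by
  rintro v ⟨⟨h1, h2⟩, h3, h4⟩
  exact ⟨⟨by linarith, by linarith⟩, by linarith, by linarith⟩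

/-- Except near the corner `(1, 1)` for `r ≤ 3`, only finitely many polygons are met. -/
lemma exists_bound_of_nonempty {r : ℕ} (hr : 1 ≤ r) {x₀ y₀ : ℝ} (hx : x₀ ≤ 1) (hy : y₀ ≤ 1)
    (h : (x₀, y₀) ≠ ((1 : ℝ), (1 : ℝ)) ∨ 4 ≤ r) :
    ∃ N : ℕ, ∃ η₀ > 0, ∀ k : Fin r → ℕ, Admissible k →
      (polygon k ∩ parallelogram k x₀ y₀ η₀).Nonempty → ∀ i, k i ≤ N := by
  obtain ⟨δ, hδ, hδ'⟩ : ∃ δ > 0, 4 ≤ r ∨ x₀ ≤ 1 - δ ∨ y₀ ≤ 1 - δ := by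
    rcases h with h | h
    · rcases hx.lt_or_eq with hx | rfl
      · exact ⟨1 - x₀, by linarith, by right; left; linarith⟩
      · rcases hy.lt_or_eq with hy | rfl
        · exact ⟨1 - y₀, by linarith, by right; right; linarith⟩
        · exact absurd rfl h
    · exact ⟨1, one_pos, Or.inl h⟩
  -- If k_i > N, then e = x_{i+1} ≤ 2/N. The bound 6 gives e < 1/3, and 8/δ gives 2e < δ/2, so both
  -- extreme coordinates exceed 1 - δ/2, whereas for r ≤ 3 the parallelogram with η = δ/2 keeps one
  -- of them below 1 - δ/2.
  obtain ⟨N, hN⟩ := exists_nat_gt (max 6 (8 / δ))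
  obtain ⟨hN6, hN8⟩ := max_lt_iff.mp hN
  refine ⟨N, δ / 2, by positivity, fun k hk => ?_⟩
  rintro ⟨v, hv, hv'⟩ i
  by_contra! hi
  have hpos := form_pos hr hv (j := i + 1) (by omega)
  have h2 := extend_mul_form_le hr hv i.isLt
  rw [extend_val] at h2
  have hi' : (N : ℝ) < k i := by exact_mod_cast hi
  have h3 : N * form (extend k) (i + 1) v ≤ 2 := by nlinarith
  have h4 : form (extend k) (i + 1) v < 1 / 3 := by nlinarith
  have h5 : 2 * form (extend k) (i + 1) v < δ / 2 := by
    rw [div_lt_iff₀ hδ] at hN8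
    have : 8 * form (extend k) (i + 1) v < N * δ * form (extend k) (i + 1) v :=
      mul_lt_mul_of_pos_right hN8 hpos
    nlinarith [mul_le_mul_of_nonneg_right h3 hδ.le]
  obtain ⟨h6, h7, h8⟩ := hk.extreme_coordinates hr hv i.isLt h4
  rw [form_last hr] at h8
  obtain ⟨⟨h9, h10⟩, h11, h12⟩ := hv'
  simp only at h9 h10 h11 h12
  rcases hδ' with h | h | h
  · omega
  · linarith
  · linarith

lemma finite_setOf_le {r : ℕ} (N : ℕ) : {k : Fin r → ℕ | ∀ i, k i ≤ N}.Finite :=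
  (Set.finite_Iic (fun _ : Fin r => N)).subset fun _ hk => hk

lemma center_mem_parallelogram {r : ℕ} {k : Fin r → ℕ} (hp : 0 < index r k) (x₀ y₀ : ℝ) {η : ℝ}
    (hη : 0 < η) : center k x₀ y₀ ∈ parallelogram k x₀ y₀ η := by
  have := add_smul_mem_parallelogram hp x₀ y₀ hη 0
  rw [smul_zero, add_zero] at this
  rw [this]
  simp [unitParallelogram]

lemma isOpen_parallelogram {r : ℕ} (k : Fin r → ℕ) (x₀ y₀ η : ℝ) :
    IsOpen (parallelogram k x₀ y₀ η) :=
  (isOpen_Ioo.prod isOpen_Ioo).preimage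
    (f := fun v : ℝ × ℝ => (v.1, (index r k : ℝ) * v.2 - (indexTail k : ℝ) * v.1)) (by fun_prop)

lemma convex_parallelogram {r : ℕ} (k : Fin r → ℕ) (x₀ y₀ η : ℝ) :
    Convex ℝ (parallelogram k x₀ y₀ η) :=
  ((convex_Ioo _ _).prod (convex_Ioo _ _)).linear_preimage
    ((LinearMap.fst ℝ ℝ ℝ).prod ((index r k : ℝ) • LinearMap.snd ℝ ℝ ℝ -
      (indexTail k : ℝ) • LinearMap.fst ℝ ℝ ℝ))

/-- If the centre is in the closure of T_k, the open parallelogram around it meets T_k, and the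
previous bound on the components applies. -/
lemma finite_center_mem_closure {r : ℕ} (hr : 1 ≤ r) {x₀ y₀ : ℝ} (hx : x₀ ≤ 1) (hy : y₀ ≤ 1)
    (h : (x₀, y₀) ≠ ((1 : ℝ), (1 : ℝ)) ∨ 4 ≤ r) :
    {k : Fin r → ℕ | Admissible k ∧ center k x₀ y₀ ∈ closure (polygon k)}.Finite := by
  obtain ⟨N, η, hη, hN⟩ := exists_bound_of_nonempty hr hx hy h
  refine (finite_setOf_le N).subset fun k ⟨hk, hC⟩ => hN k hk ?_
  have hp := index_pos hr (closure_nonempty_iff.mp ⟨_, hC⟩)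
  obtain ⟨w, h1, h2⟩ := mem_closure_iff.mp hC _ (isOpen_parallelogram k x₀ y₀ η)
    (center_mem_parallelogram hp x₀ y₀ hη)
  exact ⟨w, h2, h1⟩

/-! ### The region of the points of type `T(r)` -/

/-- The Farey triangle. -/
def triangle : Set (ℝ × ℝ) := {v | 0 < v.1 ∧ v.1 ≤ 1 ∧ 0 < v.2 ∧ v.2 ≤ 1 ∧ 1 < v.1 + v.2}

/-- The union of the sets `T_k ∩ P_k(η)` over the admissible tuples. -/
def region (r : ℕ) (x₀ y₀ η : ℝ) : Set (ℝ × ℝ) :=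
  ⋃ k ∈ {k : Fin r → ℕ | Admissible k}, polygon k ∩ parallelogram k x₀ y₀ η

lemma polygon_subset_triangle {r : ℕ} (hr : 1 ≤ r) (k : Fin r → ℕ) : polygon k ⊆ triangle := by
  intro v hv
  have h := (mem_polygon_iff_iterate k v).mp hv 0 (by omega)
  obtain ⟨h1, h2, h3, h4, h5, -⟩ := h
  exact ⟨h1, h2, h3, h4, h5⟩

lemma triangle_subset_Ioc : triangle ⊆ Set.Ioc 0 1 ×ˢ Set.Ioc 0 1 :=
  fun _ ⟨h1, h2, h3, h4, _⟩ => ⟨⟨h1, h2⟩, h3, h4⟩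

lemma region_subset_triangle {r : ℕ} (hr : 1 ≤ r) (x₀ y₀ η : ℝ) : region r x₀ y₀ η ⊆ triangle :=
  Set.iUnion₂_subset fun k _ => Set.inter_subset_left.trans (polygon_subset_triangle hr k)

lemma measurableSet_inter {r : ℕ} (hr : 1 ≤ r) (k : Fin r → ℕ) (x₀ y₀ η : ℝ) :
    MeasurableSet (polygon k ∩ parallelogram k x₀ y₀ η) := by
  rw [polygon_eq k hr]
  exact measurableSet_polyhedron.inter (isOpen_parallelogram k x₀ y₀ η).measurableSet

lemma measurableSet_region {r : ℕ} (hr : 1 ≤ r) (x₀ y₀ η : ℝ) :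
    MeasurableSet (region r x₀ y₀ η) :=
  MeasurableSet.biUnion (Set.to_countable _) fun k _ => measurableSet_inter hr k x₀ y₀ η

lemma volume_region {r : ℕ} (hr : 1 ≤ r) (x₀ y₀ η : ℝ) :
    volume (region r x₀ y₀ η) = ∑' k : Fin r → ℕ, {k | Admissible k}.indicator
      (fun k => volume (polygon k ∩ parallelogram k x₀ y₀ η)) k := by
  rw [region, measure_biUnion (Set.to_countable _) _ fun k _ => measurableSet_inter hr k x₀ y₀ η,
    tsum_subtype {k : Fin r → ℕ | Admissible k}
      (fun k => volume (polygon k ∩ parallelogram k x₀ y₀ η))]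
  intro k _ l _ hkl
  exact (polygon_disjoint hkl).mono Set.inter_subset_left Set.inter_subset_left

lemma volume_frontier_inter {r : ℕ} (hr : 1 ≤ r) (k : Fin r → ℕ) (x₀ y₀ η : ℝ) :
    volume (frontier (polygon k ∩ parallelogram k x₀ y₀ η)) = 0 := by
  refine Convex.addHaar_frontier volume (Convex.inter ?_ (convex_parallelogram k x₀ y₀ η))
  rw [polygon_eq k hr]
  exact convex_polyhedron

lemma volume_frontier_biUnion {X ι : Type*} [TopologicalSpace X] [MeasurableSpace X]
    {μ : Measure X} {F : Set ι} (hF : F.Finite) {s : ι → Set X}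
    (h : ∀ i ∈ F, μ (frontier (s i)) = 0) : μ (frontier (⋃ i ∈ F, s i)) = 0 := by
  induction F, hF using Set.Finite.induction_on with
  | empty => simp
  | @insert a F _ _ ih =>
    rw [Set.biUnion_insert]
    refine measure_mono_null (frontier_union_subset _ _) (measure_union_null ?_ ?_)
    · exact measure_mono_null Set.inter_subset_left (h a (Set.mem_insert a F))
    · exact measure_mono_null Set.inter_subset_right
        (ih fun i hi => h i (Set.mem_insert_of_mem a hi))

/-- The union of the sets `T_k ∩ P_k(η)` over the admissible tuples with components at most `N`. -/
def boundedRegion (r N : ℕ) (x₀ y₀ η : ℝ) : Set (ℝ × ℝ) :=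
  ⋃ k ∈ {k : Fin r → ℕ | Admissible k ∧ ∀ i, k i ≤ N}, polygon k ∩ parallelogram k x₀ y₀ η

lemma volume_frontier_boundedRegion {r : ℕ} (hr : 1 ≤ r) (N : ℕ) (x₀ y₀ η : ℝ) :
    volume (frontier (boundedRegion r N x₀ y₀ η)) = 0 :=
  volume_frontier_biUnion ((finite_setOf_le N).subset fun _ hk => hk.2)
    fun k _ => volume_frontier_inter hr k x₀ y₀ η

/-- Infinitely many polygons may be involved, but since k y ≤ 2 on T_k they accumulate only on the
null line y = 0. On each open half-plane y > 1/(n+1) the union is finite, and the frontier is a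
local notion. -/
lemma volume_frontier_region_one (x₀ y₀ η : ℝ) : volume (frontier (region 1 x₀ y₀ η)) = 0 := by
  have hW : ∀ n : ℕ, volume (frontier (region 1 x₀ y₀ η) ∩ {v | 1 / ((n : ℝ) + 1) < v.2}) = 0 := by
    intro n
    have hopen : IsOpen {v : ℝ × ℝ | 1 / ((n : ℝ) + 1) < v.2} :=
      isOpen_lt continuous_const continuous_snd
    rw [← frontier_inter_open_inter hopen]
    have : region 1 x₀ y₀ η ∩ {v | 1 / ((n : ℝ) + 1) < v.2} =
        boundedRegion 1 (2 * (n + 1)) x₀ y₀ η ∩ {v | 1 / ((n : ℝ) + 1) < v.2} := by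
      ext v
      simp only [region, boundedRegion, Set.mem_inter_iff, Set.mem_iUnion, Set.mem_ofPred_eq,
        exists_prop]
      refine and_congr_left fun hv => exists_congr fun k => and_congr_left fun hk => ?_
      refine ⟨fun h => ⟨h, fun i => ?_⟩, fun h => h.1⟩
      have h2 := extend_mul_form_le le_rfl hk.1 (i := 0) one_pos
      obtain rfl : i = 0 := Subsingleton.elim _ _
      rw [show extend k 0 = k 0 from extend_val k 0, zero_add, form_one] at h2
      rw [div_lt_iff₀ (by positivity)] at hv
      have h3 : (k 0 : ℝ) ≤ 2 * (n + 1) := by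
        have := mul_le_mul_of_nonneg_left hv.le (Nat.cast_nonneg (α := ℝ) (k 0))
        have := mul_le_mul_of_nonneg_right h2 (show (0 : ℝ) ≤ n + 1 by positivity)
        nlinarith
      exact_mod_cast h3
    rw [this, frontier_inter_open_inter hopen]
    exact measure_mono_null Set.inter_subset_left
      (volume_frontier_boundedRegion le_rfl _ x₀ y₀ η)
  have h0 : volume {v : ℝ × ℝ | v.2 = 0} = 0 :=
    volume_setOf_eq_zero (t := ContinuousLinearMap.snd ℝ ℝ ℝ) fun h => by
      have := congrArg (fun l : ℝ × ℝ →L[ℝ] ℝ => l (0, 1)) h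
      simp at this
  refine measure_mono_null ?_ (measure_union_null h0 (measure_iUnion_null hW))
  intro v hv
  have hv2 : 0 ≤ v.2 := by
    have hcl : IsClosed {v : ℝ × ℝ | 0 ≤ v.2} := isClosed_le continuous_const continuous_snd
    refine closure_minimal (fun w hw => ?_) hcl hv.1
    exact (region_subset_triangle le_rfl x₀ y₀ η hw).2.2.1.le
  rcases hv2.eq_or_lt with h | h
  · exact Or.inl h.symm
  · obtain ⟨n, hn⟩ := exists_nat_one_div_lt h
    exact Or.inr (Set.mem_iUnion.mpr ⟨n, hv, hn⟩)

lemma eventually_volume_frontier_region {r : ℕ} (hr : 1 ≤ r) {x₀ y₀ : ℝ} (hx : x₀ ≤ 1)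
    (hy : y₀ ≤ 1) (h : ((x₀, y₀) ≠ ((1 : ℝ), (1 : ℝ)) ∨ 4 ≤ r) ∨ r = 1) :
    ∀ᶠ η in 𝓝[>] (0 : ℝ), volume (frontier (region r x₀ y₀ η)) = 0 := by
  rcases h with h | rfl
  · obtain ⟨N, η₀, hη₀, hN⟩ := exists_bound_of_nonempty hr hx hy h
    filter_upwards [nhdsWithin_le_nhds (Iio_mem_nhds hη₀)] with η hη
    have : region r x₀ y₀ η = boundedRegion r N x₀ y₀ η := by
      ext v
      simp only [region, boundedRegion, Set.mem_iUnion, Set.mem_ofPred_eq, exists_prop]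
      refine exists_congr fun k => and_congr_left fun hk => ?_
      exact ⟨fun h => ⟨h, hN k h ⟨v, hk.1, parallelogram_mono k x₀ y₀ (le_of_lt hη) hk.2⟩⟩,
        fun h => h.1⟩
    rw [this]
    exact volume_frontier_boundedRegion hr N x₀ y₀ η
  · exact Eventually.of_forall fun η => volume_frontier_region_one x₀ y₀ η

lemma convex_triangle : Convex ℝ triangle := by
  rintro ⟨a, b⟩ ⟨h1, h2, h3, h4, h5⟩ ⟨c, d⟩ ⟨g1, g2, g3, g4, g5⟩ s t hs ht hst
  obtain rfl : t = 1 - s := by linarith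
  simp only at h1 h2 h3 h4 h5 g1 g2 g3 g4 g5
  have hcases : 0 < s ∨ 0 < 1 - s := by
    by_contra! h
    linarith
  simp only [triangle, Set.mem_ofPred_eq, Prod.smul_mk, smul_eq_mul, Prod.mk_add_mk]
  rcases hcases with h | h <;> refine ⟨?_, ?_, ?_, ?_, ?_⟩ <;> nlinarith

lemma measurableSet_triangle : MeasurableSet triangle := by
  unfold triangle
  measurability

lemma volume_triangle : volume triangle = ENNReal.ofReal (1 / 2) := by
  rw [Measure.volume_eq_prod, Measure.prod_apply measurableSet_triangle]
  have hs : ∀ x : ℝ, volume (Prod.mk x ⁻¹' triangle) =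
      (Set.Ioc (0 : ℝ) 1).indicator (fun x => ENNReal.ofReal x) x := by
    intro x
    by_cases hx : x ∈ Set.Ioc (0 : ℝ) 1
    · rw [Set.indicator_of_mem hx]
      have : Prod.mk x ⁻¹' triangle = Set.Ioc (1 - x) 1 := by
        ext y
        simp only [triangle, Set.mem_preimage, Set.mem_ofPred_eq, Set.mem_Ioc]
        obtain ⟨h1, h2⟩ := hx
        constructor
        · rintro ⟨-, -, -, h3, h4⟩
          exact ⟨by linarith, h3⟩
        · rintro ⟨h3, h4⟩
          exact ⟨h1, h2, by linarith, h4, by linarith⟩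
      rw [this, Real.volume_Ioc]
      congr 1
      ring
    · rw [Set.indicator_of_notMem hx]
      have : Prod.mk x ⁻¹' triangle = ∅ := by
        ext y
        simp only [Set.mem_preimage, Set.mem_empty_iff_false, iff_false]
        exact fun h => hx ⟨h.1, h.2.1⟩
      rw [this, measure_empty]
  simp_rw [hs]
  rw [lintegral_indicator measurableSet_Ioc, ← ofReal_integral_eq_lintegral_ofReal]
  · rw [← intervalIntegral.integral_of_le zero_le_one, integral_id]
    norm_num
  · exact (continuous_id.integrableOn_Icc (μ := volume) (a := (0 : ℝ)) (b := 1)).mono_set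
      Set.Ioc_subset_Icc_self
  · filter_upwards [ae_restrict_mem measurableSet_Ioc] with x hx using hx.1.le

/-! ### Divergence at the corner for `r = 1` -/

/-- At the corner, the quarter of the parallelogram where x < 1 and m y - x < 1 lies in T_m, and its
area is η²/m. -/
lemma one_div_le_localArea {m : ℕ} (hm : 4 ≤ m) :
    ENNReal.ofReal (1 / (m : ℝ)) ≤ localArea (fun _ : Fin 1 => m) 1 1 := by
  set k : Fin 1 → ℕ := fun _ => m with hk
  have hm' : (4 : ℝ) ≤ m := by exact_mod_cast hm
  have hm0 : (0 : ℝ) < m := by linarith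
  have hp : index 1 k = m := rfl
  have hq : indexTail k = 1 := rfl
  have hpoly : ∀ v : ℝ × ℝ, v ∈ polygon k ↔ v ∈ basicPolygon m := by
    intro v
    simp [polygon, hk]
  -- Both lower bounds defining T_m follow from y > η, which this gives because m y > 2 - 2η.
  have hev : ∀ᶠ η in 𝓝[>] (0 : ℝ), η < 1 / (m + 1 : ℝ) :=
    nhdsWithin_le_nhds (Iio_mem_nhds (by positivity))
  obtain ⟨η, ⟨h1, h2⟩, h3⟩ :=
    (((eventually_volume_eq le_rfl k 1 1).and hev).and self_mem_nhdsWithin).exists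
  have h3 : 0 < η := h3
  rw [lt_div_iff₀ (by positivity)] at h2
  have hsub : {u : ℝ × ℝ | u.1 ∈ Set.Ioo (1 - η) 1 ∧ m * u.2 - 1 * u.1 ∈ Set.Ioo (1 - η) 1} ⊆
      polygon k ∩ parallelogram k 1 1 η := by
    rintro ⟨x, y⟩ ⟨⟨ha, hb⟩, hc, hd⟩
    simp only at ha hb hc hd
    refine ⟨?_, ⟨?_, ?_⟩, ?_, ?_⟩
    · rw [hpoly, mem_basicPolygon_iff]
      simp only
      have hy0 : 0 < y := by nlinarith
      have hη : 5 * η < 1 := by nlinarith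
      refine ⟨hb.le, by nlinarith, by linarith, ?_, ?_⟩
      · by_contra! hcon
        nlinarith
      · by_contra! hcon
        nlinarith
    all_goals simp only [hp, hq, Int.cast_natCast, Int.cast_one]; linarith
  have h4 := measure_mono (μ := volume) hsub
  rw [volume_shear_preimage hm0, Real.volume_Ioo, h1, sub_sub_cancel,
    ← ENNReal.ofReal_mul h3.le, ← ENNReal.ofReal_mul (by positivity),
    show (m : ℝ)⁻¹ * (η * η) = η ^ 2 * (1 / m) by ring, ENNReal.ofReal_mul (sq_nonneg η)] at h4
  exact (ENNReal.mul_le_mul_iff_right (by simpa using h3.ne') ENNReal.ofReal_ne_top).mp h4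

/-- The even values k = 2(n + 2) contribute at least 1/(2k) each, and the harmonic series diverges.
-/
lemma densityFormula_one_corner : densityFormula 1 1 1 = ∞ := by
  have hle : ∑' n : ℕ, ENNReal.ofReal (1 / (4 * (n + 2 : ℝ))) ≤ densityFormula 1 1 1 := by
    have hinj : Function.Injective fun (n : ℕ) (_ : Fin 1) => 2 * (n + 2) := by
      intro a b hab
      have := congrFun hab 0
      simp only at this
      omega
    rw [densityFormula_eq le_rfl]
    refine le_trans (ENNReal.tsum_le_tsum fun n => ?_)
      (ENNReal.tsum_comp_le_tsum_of_injective hinj _)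
    have hA : Admissible fun _ : Fin 1 => 2 * (n + 2) := by
      refine fun i => ⟨by positivity, fun h => ?_, fun h => by omega⟩
      exact absurd h (Nat.not_odd_iff_even.mpr (even_two_mul _))
    rw [Set.indicator_of_mem (show (fun _ : Fin 1 => 2 * (n + 2)) ∈ {k | Admissible k} from hA),
      show 1 / (4 * (n + 2 : ℝ)) = 1 / ((2 * (n + 2) : ℕ) : ℝ) / 2 by
        push_cast; field_simp; norm_num,
      ENNReal.ofReal_div_of_pos two_pos, ENNReal.ofReal_ofNat]
    exact ENNReal.div_le_div_right (one_div_le_localArea (by omega)) 2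
  by_contra hne
  have hs := ENNReal.summable_toReal (ne_top_of_le_ne_top hne hle)
  refine Real.not_summable_one_div_natCast ((summable_nat_add_iff 2).mp ?_)
  refine (hs.mul_left 4).congr fun n => ?_
  rw [ENNReal.toReal_ofReal (by positivity)]
  push_cast
  field_simp

/-! ### Counting coprime lattice points with even first coordinate -/

open scoped ArithmeticFunction.Moebius

/-- The pairs `z` of natural numbers with `m ∣ z.1` and `n ∣ z.2` for which `z / Q ∈ S`. -/
def latticePoints (m n : ℕ) (S : Set (ℝ × ℝ)) (Q : ℕ) : Set (ℕ × ℕ) :=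
  {z | m ∣ z.1 ∧ n ∣ z.2 ∧ ((z.1 : ℝ) / (Q : ℝ), (z.2 : ℝ) / (Q : ℝ)) ∈ S}

/-- The pairs `z` of coprime natural numbers with even first coordinate for which `z / Q ∈ S`. -/
def evenCoprimePoints (S : Set (ℝ × ℝ)) (Q : ℕ) : Set (ℕ × ℕ) :=
  {z | Even z.1 ∧ z.1.Coprime z.2 ∧ ((z.1 : ℝ) / (Q : ℝ), (z.2 : ℝ) / (Q : ℝ)) ∈ S}

lemma pos_le_of_mem {S : Set (ℝ × ℝ)} (hS : S ⊆ Set.Ioc 0 1 ×ˢ Set.Ioc 0 1) {Q : ℕ} (hQ : 0 < Q)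
    {z : ℕ × ℕ} (hz : ((z.1 : ℝ) / (Q : ℝ), (z.2 : ℝ) / (Q : ℝ)) ∈ S) :
    0 < z.1 ∧ z.1 ≤ Q ∧ 0 < z.2 ∧ z.2 ≤ Q := by
  have hQ' : (0 : ℝ) < Q := by exact_mod_cast hQ
  obtain ⟨⟨h1, h2⟩, h3, h4⟩ := hS hz
  simp only at h1 h2 h3 h4
  rw [div_le_one hQ'] at h2 h4
  rw [lt_div_iff₀ hQ', zero_mul] at h1 h3
  exact ⟨by exact_mod_cast h1, by exact_mod_cast h2, by exact_mod_cast h3, by exact_mod_cast h4⟩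

lemma finite_points {S : Set (ℝ × ℝ)} (hS : S ⊆ Set.Ioc 0 1 ×ˢ Set.Ioc 0 1) {Q : ℕ}
    (hQ : 0 < Q) :
    {z : ℕ × ℕ | ((z.1 : ℝ) / (Q : ℝ), (z.2 : ℝ) / (Q : ℝ)) ∈ S}.Finite := by
  refine ((Set.finite_Iic Q).prod (Set.finite_Iic Q)).subset fun z hz => ?_
  obtain ⟨-, h2, -, h4⟩ := pos_le_of_mem hS hQ hz
  exact ⟨h2, h4⟩

/-- This bound is uniform in S and Q; with m = n = d it supplies the majorant 1/d² for the Möbius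
sum. -/
lemma ncard_latticePoints_le {S : Set (ℝ × ℝ)} (hS : S ⊆ Set.Ioc 0 1 ×ˢ Set.Ioc 0 1) {Q : ℕ}
    (hQ : 0 < Q) {m n : ℕ} (hm : 0 < m) (hn : 0 < n) :
    (latticePoints m n S Q).ncard * (m * n) ≤ Q ^ 2 := by
  have hsub : latticePoints m n S Q ⊆
      ((Finset.Icc 1 (Q / m) ×ˢ Finset.Icc 1 (Q / n)).image fun w => (m * w.1, n * w.2) :
        Finset (ℕ × ℕ)) := by
    rintro ⟨a, b⟩ ⟨⟨i, hi⟩, ⟨j, hj⟩, hz⟩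
    obtain ⟨h1, h2, h3, h4⟩ := pos_le_of_mem hS hQ hz
    simp only at hi hj h1 h2 h3 h4
    subst hi hj
    simp only [Finset.coe_image, Finset.coe_product, Finset.coe_Icc, Set.mem_image, Set.mem_prod,
      Set.mem_Icc]
    refine ⟨(i, j), ⟨⟨Nat.pos_of_mul_pos_left h1, ?_⟩, Nat.pos_of_mul_pos_left h3, ?_⟩, rfl⟩
    · rw [Nat.le_div_iff_mul_le hm, mul_comm]; exact h2
    · rw [Nat.le_div_iff_mul_le hn, mul_comm]; exact h4
  have h1 := Set.ncard_le_ncard hsub (Finset.finite_toSet _)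
  rw [Set.ncard_coe_finset] at h1
  have h2 := h1.trans Finset.card_image_le
  rw [Finset.card_product, Nat.card_Icc, Nat.card_Icc] at h2
  simp only [Nat.add_sub_cancel] at h2
  calc (latticePoints m n S Q).ncard * (m * n) ≤ (Q / m) * (Q / n) * (m * n) :=
        Nat.mul_le_mul_right _ h2
    _ = (Q / m * m) * (Q / n * n) := by ring
    _ ≤ Q * Q := Nat.mul_le_mul (Nat.div_mul_le_self Q m) (Nat.div_mul_le_self Q n)
    _ = Q ^ 2 := (sq Q).symm

/-- Dividing the axes by m and n turns the count into that of points of (1/Q)ℤ² in a bounded set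
with null frontier, whose area is Area(S)/(mn). -/
lemma tendsto_latticePoints {S : Set (ℝ × ℝ)} (hS : S ⊆ Set.Ioc 0 1 ×ˢ Set.Ioc 0 1)
    (hm : MeasurableSet S) (hf : volume (frontier S) = 0) {m n : ℕ} (hm0 : 0 < m) (hn0 : 0 < n) :
    Tendsto (fun Q : ℕ => ((latticePoints m n S Q).ncard : ℝ) / (Q : ℝ) ^ 2) atTop
      (𝓝 (volume.real S / (m * n))) := by
  have hm' : (0 : ℝ) < m := by exact_mod_cast hm0
  have hn' : (0 : ℝ) < n := by exact_mod_cast hn0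
  let D : (Fin 2 → ℝ) →ₗ[ℝ] (Fin 2 → ℝ) := Matrix.toLin' (Matrix.diagonal ![(m : ℝ), n])
  have hD : LinearMap.det D = m * n := by
    simp [D, LinearMap.det_toLin', Matrix.det_diagonal]
  have hD0 : LinearMap.det D ≠ 0 := by rw [hD]; positivity
  have hDa : ∀ w, MeasurableEquiv.finTwoArrow (D w) = (m * w 0, n * w 1) := by
    intro w
    simp [D, MeasurableEquiv.finTwoArrow]
  let S₂ : Set (Fin 2 → ℝ) := MeasurableEquiv.finTwoArrow ⁻¹' S
  let s : Set (Fin 2 → ℝ) := D ⁻¹' S₂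
  have hmem : ∀ w : Fin 2 → ℝ, w ∈ s ↔ (m * w 0, n * w 1) ∈ S := fun w => by
    rw [← hDa]; exact Iff.rfl
  have hS₂ : MeasurableSet S₂ := (MeasurableEquiv.finTwoArrow (α := ℝ)).measurable hm
  have hs : MeasurableSet s := (LinearMap.continuous_of_finiteDimensional D).measurable hS₂
  have hvol : ∀ X : Set (ℝ × ℝ), MeasurableSet X →
      volume (D ⁻¹' (MeasurableEquiv.finTwoArrow ⁻¹' X)) =
        ENNReal.ofReal (m * n : ℝ)⁻¹ * volume X := by
    intro X hX
    rw [Measure.addHaar_preimage_linearMap volume hD0, hD, abs_of_pos (by positivity),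
      (volume_preserving_finTwoArrow ℝ).measure_preimage hX.nullMeasurableSet]
  have hfr : volume (frontier s) = 0 := by
    have : frontier s ⊆ D ⁻¹' (MeasurableEquiv.finTwoArrow ⁻¹' frontier S) := by
      have hc : Continuous fun w : Fin 2 → ℝ => ((m * w 0, n * w 1) : ℝ × ℝ) := by fun_prop
      have e : s = (fun w : Fin 2 → ℝ => ((m * w 0, n * w 1) : ℝ × ℝ)) ⁻¹' S := Set.ext hmem
      rw [e]
      intro w hw
      have := hc.frontier_preimage_subset S hw
      rwa [Set.mem_preimage, Set.mem_preimage, hDa]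
    refine measure_mono_null this ?_
    rw [hvol _ isClosed_frontier.measurableSet, hf, mul_zero]
  have hbd : Bornology.IsBounded s := by
    refine (Metric.isBounded_Icc (0 : Fin 2 → ℝ) 1).subset fun w hw => ?_
    obtain ⟨⟨h1, h2⟩, h3, h4⟩ := hS ((hmem w).mp hw)
    simp only at h1 h2 h3 h4
    have hm1 : (1 : ℝ) ≤ m := by exact_mod_cast hm0
    have hn1 : (1 : ℝ) ≤ n := by exact_mod_cast hn0
    have p1 : 0 < w 0 := (pos_iff_pos_of_mul_pos h1).mp hm'
    have p2 : 0 < w 1 := (pos_iff_pos_of_mul_pos h3).mp hn'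
    constructor <;> intro i <;> fin_cases i <;> simp <;> nlinarith
  have key := tendsto_card_div_pow_atTop_volume s hbd hs hfr
  have hvs : volume.real s = volume.real S / (m * n) := by
    rw [Measure.real, show volume s = _ from hvol S hm, ENNReal.toReal_mul,
      ENNReal.toReal_ofReal (by positivity), Measure.real]
    field_simp
  rw [hvs] at key
  refine key.congr' ?_
  filter_upwards [eventually_gt_atTop 0] with Q hQ
  have hQ' : (0 : ℝ) < Q := by exact_mod_cast hQ
  have : NeZero Q := ⟨hQ.ne'⟩
  rw [Fintype.card_fin]
  congr 2
  rw [Nat.card_coe_set_eq]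
  -- Since S lies in the open positive quadrant, the integer points that occur are natural, and `ψ`
  -- identifies them with the points of the scaled lattice.
  let ψ : ℕ × ℕ → (Fin 2 → ℝ) := fun z => ![(z.1 : ℝ) / (m * Q), (z.2 : ℝ) / (n * Q)]
  have hψ : Function.Injective ψ := by
    intro z w h
    have h0 := congrFun h 0
    have h1 := congrFun h 1
    simp only [ψ, Matrix.cons_val_zero, Matrix.cons_val_one] at h0 h1
    rw [div_left_inj' (by positivity)] at h0 h1
    exact Prod.ext (by exact_mod_cast h0) (by exact_mod_cast h1)
  rw [← Set.ncard_image_of_injective _ hψ]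
  congr 1
  ext w
  rw [Set.mem_inter_iff, hmem]
  constructor
  · rintro ⟨h1, h2⟩
    erw [BoxIntegral.unitPartition.mem_smul_span_iff] at h2
    obtain ⟨a, ha⟩ := h2 0
    obtain ⟨b, hb⟩ := h2 1
    simp only [algebraMap_int_eq, eq_intCast] at ha hb
    obtain ⟨⟨g1, g2⟩, g3, g4⟩ := hS h1
    simp only at g1 g2 g3 g4
    have p1 : 0 < w 0 := (pos_iff_pos_of_mul_pos g1).mp hm'
    have p2 : 0 < w 1 := (pos_iff_pos_of_mul_pos g3).mp hn'
    have a0 : 0 < a := by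
      have : (0 : ℝ) < a := by rw [ha]; positivity
      exact_mod_cast this
    have b0 : 0 < b := by
      have : (0 : ℝ) < b := by rw [hb]; positivity
      exact_mod_cast this
    lift a to ℕ using a0.le
    lift b to ℕ using b0.le
    simp only [Int.cast_natCast] at ha hb
    refine ⟨(m * a, n * b), ⟨dvd_mul_right _ _, dvd_mul_right _ _, ?_⟩, ?_⟩
    · convert h1 using 2
      · push_cast; rw [ha]; field_simp
      · push_cast; rw [hb]; field_simp
    · funext i
      fin_cases i
      · simp only [ψ]; push_cast; simp [ha]; field_simp
      · simp only [ψ]; push_cast; simp [hb]; field_simp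
  · rintro ⟨⟨_, _⟩, ⟨⟨a, rfl⟩, ⟨b, rfl⟩, h⟩, rfl⟩
    constructor
    · convert h using 2
      · simp [ψ]; field_simp
      · simp [ψ]; field_simp
    · erw [BoxIntegral.unitPartition.mem_smul_span_iff]
      intro i
      fin_cases i
      · exact ⟨a, by simp [ψ]; field_simp⟩
      · exact ⟨b, by simp [ψ]; field_simp⟩

/-- The lattice points of `S` with even first and odd second coordinate, both divisible by `d`. -/
def oddMultiples (S : Set (ℝ × ℝ)) (Q d : ℕ) : Set (ℕ × ℕ) :=
  {z | Even z.1 ∧ Odd z.2 ∧ d ∣ z.1 ∧ d ∣ z.2 ∧ ((z.1 : ℝ) / (Q : ℝ), (z.2 : ℝ) / (Q : ℝ)) ∈ S}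

/-- For odd d, divisibility by 2d means even and divisible by d, so the odd second coordinates are
obtained by subtracting the even ones. -/
lemma ncard_oddMultiples {S : Set (ℝ × ℝ)} (hS : S ⊆ Set.Ioc 0 1 ×ˢ Set.Ioc 0 1) {Q : ℕ}
    (hQ : 0 < Q) {d : ℕ} (hd : Odd d) :
    (latticePoints (2 * d) d S Q).ncard =
      (oddMultiples S Q d).ncard + (latticePoints (2 * d) (2 * d) S Q).ncard := by
  have h2d : ∀ a : ℕ, 2 * d ∣ a ↔ Even a ∧ d ∣ a := fun a => by
    rw [even_iff_two_dvd]
    exact ⟨fun h => ⟨dvd_of_mul_right_dvd h, dvd_of_mul_left_dvd h⟩,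
      fun h => Nat.Coprime.mul_dvd_of_dvd_of_dvd (Nat.coprime_two_left.mpr hd) h.1 h.2⟩
  have hfin := finite_points hS hQ
  rw [← Set.ncard_union_eq _ (hfin.subset fun z h => h.2.2.2.2) (hfin.subset fun z h => h.2.2)]
  · congr 1
    ext z
    simp only [latticePoints, oddMultiples, Set.mem_union, Set.mem_ofPred_eq, h2d]
    have := Nat.even_or_odd z.2
    tauto
  · rw [Set.disjoint_left]
    intro z h1 h2
    exact Nat.not_even_iff_odd.mpr h1.2.1 ((h2d _).mp h2.2.1).1

lemma sum_moebius_divisors (n : ℕ) :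
    ∑ d ∈ n.divisors, μ d = if n = 1 then 1 else 0 := by
  rw [← ArithmeticFunction.coe_mul_zeta_apply, ArithmeticFunction.moebius_mul_coe_zeta,
    ArithmeticFunction.one_apply]

/-- Coprimality to an even number forces the second coordinate to be odd, so every common divisor is
odd. Möbius inversion over the divisors of the gcd, all at most Q, followed by exchanging the sums,
gives the formula. -/
lemma ncard_evenCoprimePoints {S : Set (ℝ × ℝ)} (hS : S ⊆ Set.Ioc 0 1 ×ˢ Set.Ioc 0 1) {Q : ℕ}
    (hQ : 0 < Q) :
    ((evenCoprimePoints S Q).ncard : ℤ) =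
      ∑ d ∈ Finset.range (Q + 1), if Odd d then μ d * ((oddMultiples S Q d).ncard : ℤ) else 0 := by
  classical
  have hfin := finite_points hS hQ
  set A : Finset (ℕ × ℕ) := hfin.toFinset.filter fun z => Even z.1 ∧ Odd z.2 with hA
  have hmemA : ∀ z, z ∈ A ↔ ((z.1 : ℝ) / (Q : ℝ), (z.2 : ℝ) / (Q : ℝ)) ∈ S ∧
      Even z.1 ∧ Odd z.2 := by
    intro z
    simp [hA]
  have h1 : evenCoprimePoints S Q = (A.filter fun z => z.1.Coprime z.2 : Finset (ℕ × ℕ)) := by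
    ext z
    simp only [evenCoprimePoints, Set.mem_ofPred_eq, Finset.coe_filter, hmemA]
    constructor
    · rintro ⟨h1, h2, h3⟩
      refine ⟨⟨h3, h1, ?_⟩, h2⟩
      by_contra h4
      have h4 := Nat.not_odd_iff_even.mp h4
      have := Nat.dvd_gcd h1.two_dvd h4.two_dvd
      rw [Nat.Coprime.gcd_eq_one h2] at this
      omega
    · rintro ⟨⟨h3, h1, -⟩, h2⟩
      exact ⟨h1, h2, h3⟩
  have h2 : ∀ d, oddMultiples S Q d = (A.filter fun z => d ∣ z.1 ∧ d ∣ z.2 : Finset (ℕ × ℕ)) := by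
    intro d
    ext z
    simp only [oddMultiples, Set.mem_ofPred_eq, Finset.coe_filter, hmemA]
    tauto
  rw [h1, Set.ncard_coe_finset, Finset.card_filter]
  simp_rw [h2, Set.ncard_coe_finset, Finset.card_filter]
  push_cast
  simp_rw [Finset.mul_sum]
  have h3 : ∀ z ∈ A, (if z.1.Coprime z.2 then (1 : ℤ) else 0) =
      ∑ d ∈ Finset.range (Q + 1), if Odd d then
        μ d * (if d ∣ z.1 ∧ d ∣ z.2 then (1 : ℤ) else 0) else 0 := by
    intro z hz
    obtain ⟨hzS, he, ho⟩ := (hmemA z).mp hz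
    obtain ⟨p1, p2, p3, p4⟩ := pos_le_of_mem hS hQ hzS
    have hg : Nat.gcd z.1 z.2 ≠ 0 := (Nat.gcd_pos_of_pos_left _ p1).ne'
    simp only [Nat.coprime_iff_gcd_eq_one]
    rw [← sum_moebius_divisors]
    have : (Nat.gcd z.1 z.2).divisors ⊆ Finset.range (Q + 1) := by
      intro d hd
      have := Nat.le_of_dvd p1 ((Nat.dvd_of_mem_divisors hd).trans (Nat.gcd_dvd_left _ _))
      rw [Finset.mem_range]
      omega
    rw [← Finset.sum_subset this]
    · refine Finset.sum_congr rfl fun d hd => ?_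
      have hdvd := Nat.dvd_gcd_iff.mp (Nat.dvd_of_mem_divisors hd)
      have hodd : Odd d := ho.of_dvd_nat hdvd.2
      rw [if_pos hodd, if_pos hdvd, mul_one]
    · intro d _ hd
      have : ¬ (d ∣ z.1 ∧ d ∣ z.2) := fun h =>
        hd (Nat.mem_divisors.mpr ⟨Nat.dvd_gcd h.1 h.2, hg⟩)
      rw [if_neg this, mul_zero, ite_self]
  rw [Finset.sum_congr rfl h3, Finset.sum_comm]
  refine Finset.sum_congr rfl fun d _ => ?_
  split_ifs <;> simp

/-- The density of the pairs of coprime numbers with even first coordinate. -/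
def evenCoprimeDensity : ℝ := ∑' d : ℕ, if Odd d then (μ d : ℝ) * (1 / (4 * (d : ℝ) ^ 2)) else 0

/-- Four times this number is the Dirichlet series of χ μ at 2, with χ the trivial character modulo
2, and its product with L(2, χ) is 1. The value itself is not needed, as it cancels in the
proportion. -/
lemma evenCoprimeDensity_ne_zero : evenCoprimeDensity ≠ 0 := by
  have h := DirichletCharacter.LSeries.mul_mu_eq_one (1 : DirichletCharacter ℂ 2) (s := 2)
    (by norm_num)
  intro h0
  have hz : LSeries ((fun n : ℕ => (1 : DirichletCharacter ℂ 2) n) *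
      fun n : ℕ => (μ n : ℂ)) 2 = 0 := by
    have : ∀ n : ℕ, LSeries.term ((fun n : ℕ => (1 : DirichletCharacter ℂ 2) n) *
          fun n : ℕ => (μ n : ℂ)) 2 n =
        ((4 * (if Odd n then (μ n : ℝ) * (1 / (4 * (n : ℝ) ^ 2)) else 0) : ℝ) : ℂ) := by
      intro n
      rcases eq_or_ne n 0 with rfl | hn
      · simp
      rw [LSeries.term_of_ne_zero hn]
      have hc : (n : ℂ) ^ (2 : ℂ) = (n : ℂ) ^ 2 := by
        rw [← Nat.cast_two, Complex.cpow_natCast]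
      rw [hc, Pi.mul_apply]
      have hn' : (n : ℂ) ≠ 0 := by exact_mod_cast hn
      by_cases ho : Odd n
      · have hu : IsUnit (n : ZMod 2) := (ZMod.isUnit_iff_coprime n 2).mpr
          (Nat.coprime_two_right.mpr ho)
        rw [MulChar.one_apply hu, if_pos ho]
        push_cast
        field_simp
      · have hu : ¬ IsUnit (n : ZMod 2) := fun h => ho
          (Nat.coprime_two_right.mp ((ZMod.isUnit_iff_coprime n 2).mp h))
        rw [MulChar.map_nonunit _ hu, if_neg ho]
        simp
    rw [LSeries, tsum_congr this, ← Complex.ofReal_tsum, tsum_mul_left]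
    rw [evenCoprimeDensity] at h0
    rw [h0]
    simp
  rw [hz, mul_zero] at h
  exact zero_ne_one h

/-- The Möbius sum converges termwise, with term constants 1/(2d²) - 1/(4d²) = 1/(4d²), and is
dominated by 1/d². Terms with d > Q vanish, so the finite sum may be written as an infinite one. -/
lemma tendsto_evenCoprimePoints {S : Set (ℝ × ℝ)} (hS : S ⊆ Set.Ioc 0 1 ×ˢ Set.Ioc 0 1)
    (hm : MeasurableSet S) (hf : volume (frontier S) = 0) :
    Tendsto (fun Q : ℕ => ((evenCoprimePoints S Q).ncard : ℝ) / (Q : ℝ) ^ 2) atTop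
      (𝓝 (evenCoprimeDensity * volume.real S)) := by
  let F : ℕ → ℕ → ℝ := fun Q d =>
    if Odd d then (μ d : ℝ) * (((oddMultiples S Q d).ncard : ℝ) / (Q : ℝ) ^ 2) else 0
  have hterm : ∀ d, Tendsto (fun Q => F Q d) atTop
      (𝓝 (if Odd d then (μ d : ℝ) * (1 / (4 * (d : ℝ) ^ 2)) * volume.real S else 0)) := by
    intro d
    by_cases hd : Odd d
    · simp only [F, if_pos hd]
      rw [mul_assoc]
      refine Tendsto.const_mul _ ?_
      have hd0 : 0 < d := hd.pos
      have hd' : (0 : ℝ) < d := by exact_mod_cast hd0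
      have h1 := tendsto_latticePoints hS hm hf (m := 2 * d) (n := d) (by omega) hd0
      have h2 := tendsto_latticePoints hS hm hf (m := 2 * d) (n := 2 * d) (by omega) (by omega)
      have h3 := h1.sub h2
      have e : volume.real S / (((2 * d : ℕ) : ℝ) * d) -
          volume.real S / (((2 * d : ℕ) : ℝ) * ((2 * d : ℕ) : ℝ)) =
          1 / (4 * (d : ℝ) ^ 2) * volume.real S := by
        push_cast
        field_simp
        ring
      rw [e] at h3
      refine h3.congr' ?_
      filter_upwards [eventually_gt_atTop 0] with Q hQ
      rw [ncard_oddMultiples hS hQ hd]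
      push_cast
      ring
    · simp only [F, if_neg hd]
      exact tendsto_const_nhds
  have hbound : ∀ᶠ Q : ℕ in atTop, ∀ d, ‖F Q d‖ ≤ 1 / (d : ℝ) ^ 2 := by
    filter_upwards [eventually_gt_atTop 0] with Q hQ d
    by_cases hd : Odd d
    · simp only [F, if_pos hd]
      have hd0 : 0 < d := hd.pos
      have hd' : (0 : ℝ) < d := by exact_mod_cast hd0
      have hQ' : (0 : ℝ) < Q := by exact_mod_cast hQ
      have h1 := ncard_latticePoints_le hS hQ hd0 hd0
      have h2 : (oddMultiples S Q d).ncard ≤ (latticePoints d d S Q).ncard := by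
        refine Set.ncard_le_ncard (fun z h => ⟨h.2.2.1, h.2.2.2.1, h.2.2.2.2⟩)
          ((finite_points hS hQ).subset fun z h => h.2.2)
      have h3 : ((oddMultiples S Q d).ncard : ℝ) * d ^ 2 ≤ Q ^ 2 := by
        have := (Nat.mul_le_mul_right (d * d) h2).trans h1
        rw [← sq] at this
        exact_mod_cast this
      have h4 : |(μ d : ℝ)| ≤ 1 := by exact_mod_cast ArithmeticFunction.abs_moebius_le_one
      rw [norm_mul, Real.norm_eq_abs, Real.norm_of_nonneg (by positivity)]
      refine (mul_le_of_le_one_left (by positivity) h4).trans ?_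
      rw [div_le_div_iff₀ (by positivity) (by positivity)]
      linarith
    · simp only [F, if_neg hd, norm_zero]
      positivity
  have key := tendsto_tsum_of_dominated_convergence
    (Real.summable_one_div_nat_pow.mpr one_lt_two) hterm hbound
  have hlim : ∑' d : ℕ, (if Odd d then (μ d : ℝ) * (1 / (4 * (d : ℝ) ^ 2)) * volume.real S else 0)
      = evenCoprimeDensity * volume.real S := by
    rw [evenCoprimeDensity, ← tsum_mul_right]
    refine tsum_congr fun d => ?_
    rw [ite_mul, zero_mul]
  rw [hlim] at key
  refine key.congr' ?_
  filter_upwards [eventually_gt_atTop 0] with Q hQ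
  rw [tsum_eq_sum (s := Finset.range (Q + 1))]
  · have := congrArg (fun n : ℤ => (n : ℝ)) (ncard_evenCoprimePoints hS hQ)
    simp only [Int.cast_natCast, Int.cast_sum] at this
    rw [this, Finset.sum_div]
    refine Finset.sum_congr rfl fun d _ => ?_
    simp only [F]
    split_ifs
    · push_cast
      ring
    · simp
  · intro d hd
    simp only [F]
    split_ifs
    · have : oddMultiples S Q d = ∅ := by
        ext z
        simp only [Set.mem_empty_iff_false, iff_false]
        intro hz
        obtain ⟨p1, p2, -⟩ := pos_le_of_mem hS hQ hz.2.2.2.2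
        have := Nat.le_of_dvd p1 hz.2.2.1
        rw [Finset.mem_range] at hd
        omega
      simp [this]
    · rfl

/-! ### Neighbours among the fractions with denominator at most `Q` -/

/-- `y` is the successor of `x` among the fractions with denominator at most `Q`. -/
def IsNext (Q : ℕ) (x y : ℚ) : Prop :=
  x.den ≤ Q ∧ y.den ≤ Q ∧ Q < x.den + y.den ∧ y.num * x.den - x.num * y.den = 1

lemma exists_rat_of_det {a b : ℕ} (ha : 0 < a) (hb : 0 < b) {c d : ℤ} (h : d * a - c * b = 1) :
    ∃ x y : ℚ, x.num = c ∧ x.den = a ∧ y.num = d ∧ y.den = b := by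
  have h1 : IsCoprime c (a : ℤ) := ⟨-b, d, by linarith⟩
  have h2 : IsCoprime d (b : ℤ) := ⟨a, -c, by linarith⟩
  exact ⟨⟨c, a, ha.ne', by simpa [Int.gcd] using Int.isCoprime_iff_gcd_eq_one.mp h1⟩,
    ⟨d, b, hb.ne', by simpa [Int.gcd] using Int.isCoprime_iff_gcd_eq_one.mp h2⟩, rfl, rfl, rfl, rfl⟩

lemma exists_isNext {Q : ℕ} {x : ℚ} (hx : x.den ≤ Q) : ∃ y, IsNext Q x y := by
  have hcop : IsCoprime x.num (x.den : ℤ) :=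
    Int.isCoprime_iff_gcd_eq_one.mpr (by simpa [Int.gcd] using x.reduced)
  obtain ⟨w, u, h⟩ := hcop
  have hpos : (0 : ℤ) < x.den := by exact_mod_cast x.den_pos
  have h1 := Int.emod_nonneg (Q + w) hpos.ne'
  have h2 := Int.emod_lt_of_pos (Q + w) hpos
  have h3 := Int.mul_ediv_add_emod (Q + w) x.den
  set t := (Q + w) / (x.den : ℤ) with ht
  set e := (Q + w) % (x.den : ℤ) with he
  have hxQ : (x.den : ℤ) ≤ Q := by exact_mod_cast hx
  -- The determinant condition fixes the new denominator modulo `x.den`, as the class of -w.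
  -- Subtracting the residue e of Q + w from Q picks the representative in (Q - `x.den`, Q], as
  -- required of a successor.
  obtain ⟨b, hb⟩ : ∃ b : ℕ, (b : ℤ) = Q - e := ⟨(Q - e).toNat, Int.toNat_of_nonneg (by linarith)⟩
  have hb' : (b : ℤ) = -w + x.den * t := by linarith
  obtain ⟨x', y, hc, ha, hd, hb2⟩ := exists_rat_of_det (a := x.den) (b := b) (c := x.num)
    (d := u + x.num * t) x.den_pos (by omega) (by rw [hb']; linear_combination h)
  refine ⟨y, hx, by omega, by omega, ?_⟩
  rw [hd, hb2, hb']
  linear_combination h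

lemma IsNext.lt {Q : ℕ} {x y : ℚ} (h : IsNext Q x y) : x < y := by
  rw [Rat.lt_iff]
  linarith [h.2.2.2]

/-- A fraction strictly between x and y has as denominator a combination of those of x and y with
coefficients at least 1, hence larger than Q. -/
lemma IsNext.le_of_lt {Q : ℕ} {x y z : ℚ} (h : IsNext Q x y) (hz : z.den ≤ Q) (hxz : x < z) :
    y ≤ z := by
  obtain ⟨h1, h2, h3, h4⟩ := h
  by_contra! hlt
  rw [Rat.lt_iff] at hxz hlt
  have hx : (0 : ℤ) < x.den := by exact_mod_cast x.den_pos
  have hy : (0 : ℤ) < y.den := by exact_mod_cast y.den_pos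
  have e : (z.den : ℤ) = x.den * (y.num * z.den - z.num * y.den) +
      y.den * (z.num * x.den - x.num * z.den) := by
    linear_combination (-(z.den : ℤ)) * h4
  have g1 : (1 : ℤ) ≤ y.num * z.den - z.num * y.den := by linarith
  have g2 : (1 : ℤ) ≤ z.num * x.den - x.num * z.den := by linarith
  have g3 : (z.den : ℤ) ≤ Q := by exact_mod_cast hz
  have g4 : (Q : ℤ) < x.den + y.den := by exact_mod_cast h3
  nlinarith

lemma IsNext.unique {Q : ℕ} {x y z : ℚ} (h : IsNext Q x y) (h' : IsNext Q x z) : y = z :=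
  le_antisymm (h.le_of_lt h'.2.1 h'.lt) (h'.le_of_lt h.2.1 h.lt)

lemma IsNext.coprime {Q : ℕ} {x y : ℚ} (h : IsNext Q x y) : x.den.Coprime y.den := by
  rw [← Nat.isCoprime_iff_coprime]
  exact ⟨y.num, -x.num, by linarith [h.2.2.2]⟩

/-- Equating the two determinants gives y.num (z.den + x.den) = y.den (x.num + z.num), and y is
reduced. -/
lemma IsNext.dvd {Q : ℕ} {x y z : ℚ} (h : IsNext Q x y) (h' : IsNext Q y z) :
    ∃ m : ℕ, z.den + x.den = m * y.den := by
  have h1 := h.2.2.2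
  have h2 := h'.2.2.2
  have hcop : IsCoprime (y.den : ℤ) y.num :=
    ⟨-x.num, x.den, by linarith⟩
  have hdvd : (y.den : ℤ) ∣ y.num * (z.den + x.den) :=
    ⟨x.num + z.num, by linear_combination h1 - h2⟩
  have := hcop.dvd_of_dvd_mul_left hdvd
  obtain ⟨m, hm⟩ : y.den ∣ z.den + x.den := by exact_mod_cast this
  exact ⟨m, by rw [hm, mul_comm]⟩

open Classical in
/-- The successor of `x` among the fractions with denominator at most `Q`. -/
def next (Q : ℕ) (x : ℚ) : ℚ := if h : x.den ≤ Q then (exists_isNext h).choose else x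

lemma isNext_next {Q : ℕ} {x : ℚ} (h : x.den ≤ Q) : IsNext Q x (next Q x) := by
  rw [next, dif_pos h]
  exact (exists_isNext h).choose_spec

lemma den_next_le {Q : ℕ} {x : ℚ} (h : x.den ≤ Q) : (next Q x).den ≤ Q := (isNext_next h).2.1

lemma den_iterate_le {Q : ℕ} {x : ℚ} (h : x.den ≤ Q) (j : ℕ) : ((next Q)^[j] x).den ≤ Q := by
  induction j with
  | zero => exact h
  | succ j ih => rw [Function.iterate_succ_apply']; exact den_next_le ih

/-! ### The fractions between two given ones -/

/-- The fractions with denominator at most `Q` strictly between `x` and `z`. -/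
def between (Q : ℕ) (x z : ℚ) : Set ℚ := {y | y.den ≤ Q ∧ x < y ∧ y < z}

lemma finite_setOf_den_le (Q : ℕ) (a b : ℚ) : {y : ℚ | y.den ≤ Q ∧ a ≤ y ∧ y ≤ b}.Finite := by
  obtain ⟨N, hN⟩ := exists_nat_ge (max |a| |b|)
  have hinj : Set.InjOn (fun y : ℚ => (y.num, y.den)) {y : ℚ | y.den ≤ Q ∧ a ≤ y ∧ y ≤ b} :=
    fun y _ z _ h => Rat.ext (congrArg Prod.fst h) (congrArg Prod.snd h)
  refine Set.Finite.of_finite_image (Set.Finite.subset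
    ((Set.finite_Icc (-(N * Q : ℤ)) (N * Q : ℤ)).prod (Set.finite_Iic Q)) ?_) hinj
  rintro _ ⟨y, ⟨h1, h2, h3⟩, rfl⟩
  refine ⟨?_, h1⟩
  have hy : |y| ≤ N := by
    refine (abs_le_max_abs_abs h2 h3).trans hN
  have hd : (0 : ℚ) < y.den := by exact_mod_cast y.den_pos
  have hnum : |(y.num : ℚ)| ≤ N * Q := by
    rw [← Rat.mul_den_eq_num y, abs_mul, abs_of_pos hd]
    exact mul_le_mul hy (by exact_mod_cast h1) hd.le (Nat.cast_nonneg N)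
  have : |y.num| ≤ (N * Q : ℤ) := by exact_mod_cast hnum
  exact abs_le.mp this

lemma finite_between (Q : ℕ) (x z : ℚ) : (between Q x z).Finite :=
  (finite_setOf_den_le Q x z).subset fun _ h => ⟨h.1, h.2.1.le, h.2.2.le⟩

lemma between_eq_insert {Q : ℕ} {x z : ℚ} (hx : x.den ≤ Q) (h : next Q x < z) :
    between Q x z = insert (next Q x) (between Q (next Q x) z) := by
  have hn := isNext_next hx
  ext y
  rw [Set.mem_insert_iff]
  constructor
  · rintro ⟨h1, h2, h3⟩
    rcases (hn.le_of_lt h1 h2).eq_or_lt with h | h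
    · exact Or.inl h.symm
    · exact Or.inr ⟨h1, h, h3⟩
  · rintro (rfl | ⟨h1, h2, h3⟩)
    · exact ⟨hn.2.1, hn.lt, h⟩
    · exact ⟨h1, hn.lt.trans h2, h3⟩

lemma ncard_between_eq {Q : ℕ} {x z : ℚ} (hx : x.den ≤ Q) (h : next Q x < z) :
    (between Q x z).ncard = (between Q (next Q x) z).ncard + 1 := by
  rw [between_eq_insert hx h, Set.ncard_insert_of_notMem (fun h => lt_irrefl _ h.2.1)
    (finite_between _ _ _)]

lemma iterate_of_ncard_between {Q n : ℕ} {x z : ℚ} (hx : x.den ≤ Q) (hz : z.den ≤ Q)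
    (hxz : x < z) (h : (between Q x z).ncard = n) :
    (next Q)^[n + 1] x = z ∧ ∀ j < n, (next Q)^[j + 1] x ∈ between Q x z := by
  induction n generalizing x with
  | zero =>
    rw [Set.ncard_eq_zero (finite_between _ _ _)] at h
    refine ⟨?_, fun j hj => by omega⟩
    have hn := isNext_next hx
    rcases (hn.le_of_lt hz hxz).eq_or_lt with h' | h'
    · exact h'
    · have : next Q x ∈ between Q x z := ⟨hn.2.1, hn.lt, h'⟩
      rw [h] at this
      exact absurd this (Set.notMem_empty _)
  | succ n ih =>
    have hn := isNext_next hx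
    obtain ⟨y, h1, h2, h3⟩ : (between Q x z).Nonempty := by
      rw [← Set.ncard_pos (finite_between _ _ _)]
      omega
    have hlt : next Q x < z := (hn.le_of_lt h1 h2).trans_lt h3
    rw [ncard_between_eq hx hlt] at h
    obtain ⟨g1, g2⟩ := ih hn.2.1 hlt (by omega)
    refine ⟨g1, fun j hj => ?_⟩
    rw [between_eq_insert hx hlt]
    rcases j with _ | j
    · exact Set.mem_insert _ _
    · exact Set.mem_insert_of_mem _ (g2 j (by omega))

lemma lt_iterate {Q : ℕ} {x : ℚ} (hx : x.den ≤ Q) (n : ℕ) : x < (next Q)^[n + 1] x := by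
  induction n generalizing x with
  | zero => exact (isNext_next hx).lt
  | succ n ih => exact (isNext_next hx).lt.trans (ih (den_next_le hx))

lemma between_iterate {Q : ℕ} {x : ℚ} (hx : x.den ≤ Q) (n : ℕ) :
    (between Q x ((next Q)^[n + 1] x)).ncard = n ∧
      ∀ y ∈ between Q x ((next Q)^[n + 1] x), ∃ j < n, y = (next Q)^[j + 1] x := by
  induction n generalizing x with
  | zero =>
    have : between Q x ((next Q)^[0 + 1] x) = ∅ := by
      ext y
      simp only [Set.mem_empty_iff_false, iff_false]
      exact fun h => not_lt_of_ge ((isNext_next hx).le_of_lt h.1 h.2.1) h.2.2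
    rw [this]
    exact ⟨Set.ncard_empty _, fun y hy => absurd hy (Set.notMem_empty y)⟩
  | succ n ih =>
    have hlt : next Q x < (next Q)^[n + 1 + 1] x := lt_iterate (den_next_le hx) n
    obtain ⟨h1, h2⟩ := ih (den_next_le hx)
    refine ⟨?_, ?_⟩
    · rw [ncard_between_eq hx hlt]
      exact congrArg (· + 1) h1
    · intro y hy
      rw [between_eq_insert hx hlt] at hy
      rcases hy with rfl | hy
      · exact ⟨0, by omega, rfl⟩
      · obtain ⟨j, hj, rfl⟩ := h2 y hy
        exact ⟨j + 1, by omega, rfl⟩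

/-! ### The point of the Farey triangle attached to a fraction -/

/-- The point `(q / Q, q' / Q)`, where `q` and `q'` are the denominators of `x` and of its
successor. -/
def denPoint (Q : ℕ) (x : ℚ) : ℝ × ℝ := ((x.den : ℝ) / (Q : ℝ), ((next Q x).den : ℝ) / (Q : ℝ))

/-- The quotient `(q + q'') / q'`, where `q`, `q'`, `q''` are the denominators of `x` and its two
successors. -/
def quotient (Q : ℕ) (x : ℚ) : ℕ :=
  ((next Q (next Q x)).den + x.den) / (next Q x).den

lemma quotient_spec {Q : ℕ} {x : ℚ} (hx : x.den ≤ Q) :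
    (next Q (next Q x)).den + x.den = quotient Q x * (next Q x).den := by
  obtain ⟨m, hm⟩ := (isNext_next hx).dvd (isNext_next (den_next_le hx))
  rw [quotient, hm, Nat.mul_div_cancel _ (next Q x).den_pos]

lemma denPoint_mem_triangle {Q : ℕ} {x : ℚ} (hx : x.den ≤ Q) : denPoint Q x ∈ triangle := by
  obtain ⟨-, h2, h3, -⟩ := isNext_next hx
  have hQ : (0 : ℝ) < Q := by exact_mod_cast x.den_pos.trans_le hx
  have p1 : (0 : ℝ) < x.den := by exact_mod_cast x.den_pos
  have p2 : (0 : ℝ) < (next Q x).den := by exact_mod_cast (next Q x).den_pos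
  refine ⟨div_pos p1 hQ, ?_, div_pos p2 hQ, ?_, ?_⟩
  · exact (div_le_one hQ).mpr (by exact_mod_cast hx)
  · exact (div_le_one hQ).mpr (by exact_mod_cast h2)
  · simp only [denPoint]
    rw [← add_div, lt_div_iff₀ hQ, one_mul]
    exact_mod_cast h3

lemma quotient_mul_sub {Q : ℕ} {x : ℚ} (hx : x.den ≤ Q) :
    (quotient Q x : ℝ) * (denPoint Q x).2 - (denPoint Q x).1 = (denPoint Q (next Q x)).2 := by
  have h : ((next Q (next Q x)).den : ℝ) + x.den = quotient Q x * (next Q x).den := by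
    exact_mod_cast quotient_spec hx
  have hQ : (0 : ℝ) < Q := by exact_mod_cast x.den_pos.trans_le hx
  simp only [denPoint]
  field_simp
  linarith

lemma denPoint_mem_basicPolygon {Q : ℕ} {x : ℚ} (hx : x.den ≤ Q) :
    denPoint Q x ∈ basicPolygon (quotient Q x) := by
  rw [mem_basicPolygon_iff, quotient_mul_sub hx]
  obtain ⟨-, h1, -, h2, h3⟩ := denPoint_mem_triangle hx
  obtain ⟨-, -, -, g2, g3⟩ := denPoint_mem_triangle (den_next_le hx)
  exact ⟨h1, h2, g2, h3, g3⟩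

/-- The dictionary between arithmetic and dynamics: passing to the next fraction is one step of the
map. -/
lemma fareyMap_denPoint {Q : ℕ} {x : ℚ} (hx : x.den ≤ Q) :
    fareyMap (denPoint Q x) = denPoint Q (next Q x) := by
  rw [fareyMap_of_mem (denPoint_mem_basicPolygon hx), quotient_mul_sub hx]
  rfl

lemma iterate_fareyMap_denPoint {Q : ℕ} {x : ℚ} (hx : x.den ≤ Q) (j : ℕ) :
    fareyMap^[j] (denPoint Q x) = denPoint Q ((next Q)^[j] x) := by
  induction j with
  | zero => rfl
  | succ j ih =>
    rw [Function.iterate_succ_apply', ih, fareyMap_denPoint (den_iterate_le hx j),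
      Function.iterate_succ_apply']

/-- The tuple of the first `r` quotients. -/
def quotients (r Q : ℕ) (x : ℚ) (i : Fin r) : ℕ := quotient Q ((next Q)^[i] x)

lemma denPoint_mem_polygon {Q : ℕ} {x : ℚ} (hx : x.den ≤ Q) (r : ℕ) :
    denPoint Q x ∈ polygon (quotients r Q x) := by
  simp only [polygon, Set.mem_iInter, Set.mem_preimage]
  intro i
  rw [iterate_fareyMap_denPoint hx]
  exact denPoint_mem_basicPolygon (den_iterate_le hx i)

lemma denPoint_mem_parallelogram_iff {r Q : ℕ} (hr : 1 ≤ r) {x : ℚ} (hx : x.den ≤ Q)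
    (x₀ y₀ η : ℝ) : denPoint Q x ∈ parallelogram (quotients r Q x) x₀ y₀ η ↔
      ((x.den : ℝ) / (Q : ℝ), (((next Q)^[r + 1] x).den : ℝ) / (Q : ℝ)) ∈ square x₀ y₀ η := by
  have h := iterate_fareyMap ((mem_polygon_iff_iterate _ _).mp (denPoint_mem_polygon hx r)) r le_rfl
  rw [iterate_fareyMap_denPoint hx] at h
  have h2 := congrArg Prod.snd h
  simp only at h2
  rw [form_last hr] at h2
  rw [parallelogram, Set.mem_ofPred_eq, ← h2, Function.iterate_succ_apply']
  exact Iff.rfl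

/-- The parities of the chain of denominators of a pair of type `T(r)`. -/
def ParityChain (r Q : ℕ) (x : ℚ) : Prop :=
  (∀ j < r, Odd ((next Q)^[j + 1] x).den) ∧ Even ((next Q)^[r + 1] x).den

/-- When q_{i+1} is odd, k_i has the parity of q_i + q_{i+2}. In an even, odd, …, odd, even chain
this sum is odd exactly when one of its two terms is an end of the chain, that is, at the first and
last i unless they coincide. Conversely these parities propagate along the chain from q_0 even and
q_1 odd. -/
lemma parityChain_iff {r Q : ℕ} (hr : 1 ≤ r) {x : ℚ} (hx : x.den ≤ Q) (he : Even x.den) :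
    ParityChain r Q x ↔ Admissible (quotients r Q x) := by
  set q : ℕ → ℕ := fun j => ((next Q)^[j] x).den with hq
  have hq0 : Even (q 0) := he
  have hpos : ∀ j, 0 < q j := fun j => ((next Q)^[j] x).den_pos
  have hrec : ∀ i : Fin r, q (i + 2) + q i = quotients r Q x i * q (i + 1) := by
    intro i
    have := quotient_spec (den_iterate_le hx (i : ℕ))
    rw [← Function.iterate_succ_apply' (next Q) i x,
      ← Function.iterate_succ_apply' (next Q) (i + 1) x] at this
    exact this
  have hcop : Odd (q 1) := by
    by_contra h
    have h := Nat.not_odd_iff_even.mp h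
    have h1 : (q 0).Coprime (q 1) := (isNext_next hx).coprime
    have := Nat.dvd_gcd hq0.two_dvd h.two_dvd
    rw [h1.gcd_eq_one] at this
    omega
  change ((∀ j < r, Odd (q (j + 1))) ∧ Even (q (r + 1))) ↔ _
  constructor
  · rintro ⟨h1, h2⟩ i
    have hi := hrec i
    refine ⟨Nat.pos_of_ne_zero fun h0 => ?_, ?_⟩
    · rw [h0] at hi
      have := hpos i
      omega
    have ho : Odd (q (i + 1)) := h1 i i.isLt
    have e1 : Odd (quotients r Q x i) ↔ Odd (q (i + 2) + q i) := by
      rw [hi, Nat.odd_mul]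
      exact ⟨fun h => ⟨h, ho⟩, fun h => h.1⟩
    rw [e1, Nat.odd_add]
    have hleft : Even (q i) ↔ (i : ℕ) = 0 := by
      constructor
      · intro h
        by_contra hne
        obtain ⟨j, hj⟩ := Nat.exists_eq_succ_of_ne_zero hne
        rw [hj] at h
        exact Nat.not_odd_iff_even.mpr h (h1 j (by omega))
      · intro h
        rw [h]
        exact hq0
    have hright : Odd (q (i + 2)) ↔ (i : ℕ) + 1 ≠ r := by
      constructor
      · intro h hne
        rw [show (i : ℕ) + 2 = r + 1 by omega] at h
        exact Nat.not_odd_iff_even.mpr h2 h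
      · intro h
        exact h1 (i + 1) (by omega)
    rw [hleft, hright]
    omega
  · intro h
    have step : ∀ i : Fin r, Odd (q (i + 1)) →
        (Odd (q (i + 2)) ↔ (Even (q i) ↔ (2 ≤ r ∧ ((i : ℕ) = 0 ∨ (i : ℕ) + 1 = r)))) := by
      intro i ho
      rw [← (h i).2]
      have e1 : Odd (quotients r Q x i) ↔ Odd (q (i + 2) + q i) := by
        rw [hrec i, Nat.odd_mul]
        exact ⟨fun h => ⟨h, ho⟩, fun h => h.1⟩
      rw [e1, Nat.odd_add]
      tauto
    have hodd : ∀ j < r, Odd (q (j + 1)) := by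
      intro j
      induction j using Nat.strong_induction_on with
      | _ j ih =>
        intro hj
        rcases j with _ | j
        · exact hcop
        refine (step ⟨j, by omega⟩ (ih j (by omega) (by omega))).mpr ?_
        rcases j with _ | j
        · simp only [hq0, true_iff, true_or, and_true]
          omega
        · have : ¬ Even (q (j + 1)) :=
            Nat.not_even_iff_odd.mpr (ih j (by omega) (by omega))
          simp only [this, false_iff]
          omega
    refine ⟨hodd, ?_⟩
    have hs := step ⟨r - 1, by omega⟩ (by
      have := hodd (r - 1) (by omega)
      exact this)
    simp only [show r - 1 + 2 = r + 1 by omega, show r - 1 + 1 = r by omega, or_true,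
      and_true] at hs
    rw [← Nat.not_odd_iff_even, hs]
    rcases Nat.lt_or_ge 1 r with h1 | h1
    · have : ¬ Even (q (r - 1)) := by
        rw [Nat.not_even_iff_odd]
        have := hodd (r - 2) (by omega)
        rwa [show r - 2 + 1 = r - 1 by omega] at this
      simp only [this, false_iff, not_not]
      omega
    · obtain rfl : r = 1 := by omega
      simp [hq0]

/-! ### Counting pairs of even Farey fractions -/

lemma finite_fareyEven (Q : ℕ) : (fareyEven Q).Finite :=
  (finite_setOf_den_le Q 0 1).subset fun _ h => ⟨h.1.2.2, h.1.1.le, h.1.2.1⟩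

/-- A fraction in (0, 1] is determined by its own denominator q and that of its successor, since the
determinant fixes its numerator modulo q. Conversely, a coprime pair in the triangle determines such
a fraction, because sum > Q is exactly the neighbour condition. -/
lemma ncard_fareyEven_inter {S : Set (ℝ × ℝ)} (hS : S ⊆ triangle) {Q : ℕ} (hQ : 0 < Q) :
    {x | x ∈ fareyEven Q ∧ denPoint Q x ∈ S}.ncard = (evenCoprimePoints S Q).ncard := by
  have hQ' : (0 : ℝ) < Q := by exact_mod_cast hQ
  have hinj : Set.InjOn (fun x : ℚ => (x.den, (next Q x).den))
      {x | x ∈ fareyEven Q ∧ denPoint Q x ∈ S} := by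
    rintro x ⟨⟨⟨x1, x2, x3⟩, -⟩, -⟩ y ⟨⟨⟨y1, y2, y3⟩, -⟩, -⟩ hxy
    obtain ⟨h1, h2⟩ := Prod.ext_iff.mp hxy
    simp only at h1 h2
    have hx := isNext_next x3
    have hy := isNext_next y3
    refine Rat.ext ?_ h1
    have hcop : IsCoprime (x.den : ℤ) ((next Q x).den : ℤ) :=
      Nat.isCoprime_iff_coprime.mpr hx.coprime
    have ex := hx.2.2.2
    have ey := hy.2.2.2
    rw [← h1, ← h2] at ey
    have hdvd : (x.den : ℤ) ∣ (next Q x).den * (x.num - y.num) :=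
      ⟨(next Q x).num - (next Q y).num, by linear_combination ey - ex⟩
    obtain ⟨t, ht⟩ := hcop.dvd_of_dvd_mul_left hdvd
    have hd : (0 : ℤ) < x.den := by exact_mod_cast x.den_pos
    have nx0 : 0 < x.num := Rat.num_pos.mpr x1
    have ny0 : 0 < y.num := Rat.num_pos.mpr y1
    have nx1 : x.num ≤ x.den := Rat.num_le_denom_iff.mpr x2
    have ny1 : y.num ≤ x.den := by rw [h1]; exact Rat.num_le_denom_iff.mpr y2
    have t1 : t < 1 := by nlinarith
    have t2 : -1 < t := by nlinarith
    obtain rfl : t = 0 := by omega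
    linarith
  rw [← hinj.ncard_image]
  congr 1
  ext ⟨a, b⟩
  constructor
  · rintro ⟨x, ⟨⟨hx, he⟩, hxS⟩, hab⟩
    obtain ⟨rfl, rfl⟩ := Prod.ext_iff.mp hab
    exact ⟨he, (isNext_next hx.2.2).coprime, hxS⟩
  · rintro ⟨he, hc, hab⟩
    simp only at he hc hab
    have htri := hS hab
    obtain ⟨a0, aQ, b0, bQ⟩ := pos_le_of_mem triangle_subset_Ioc hQ (z := (a, b)) htri
    simp only at a0 aQ b0 bQ
    have hsum : Q < a + b := by
      have := htri.2.2.2.2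
      simp only at this
      rw [← add_div, lt_div_iff₀ hQ', one_mul] at this
      exact_mod_cast this
    obtain ⟨u, w, h⟩ := Nat.isCoprime_iff_coprime.mpr hc
    have ha : (0 : ℤ) < a := by exact_mod_cast a0
    have h1 := Int.emod_nonneg (-w) ha.ne'
    have h2 := Int.emod_lt_of_pos (-w) ha
    have h3 := Int.mul_ediv_add_emod (-w) a
    set c := (-w) % (a : ℤ) with hcdef
    set t := (-w) / (a : ℤ)
    -- A zero residue would make a divide 1, but a is even; so c lies in [1, a - 1] and the fraction
    -- in (0, 1).
    have hc0 : c ≠ 0 := by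
      intro hc0
      have hunit : (a : ℤ) ∣ 1 := ⟨u - t * b, by rw [hc0] at h3; linear_combination -h + b * h3⟩
      have ha1 : a = 1 := by
        have := Int.eq_one_of_dvd_one ha.le hunit
        exact_mod_cast this
      rw [ha1] at he
      exact absurd he (by decide)
    obtain ⟨x, y, hxn, hxd, hyn, hyd⟩ := exists_rat_of_det a0 b0 (c := c) (d := u - t * b)
      (by linear_combination h - b * h3)
    have hnext : IsNext Q x y := by
      refine ⟨by omega, by omega, by omega, ?_⟩
      rw [hxn, hxd, hyn, hyd]
      linear_combination h - b * h3
    have hxQ : x.den ≤ Q := hnext.1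
    have hxy : next Q x = y := (isNext_next hxQ).unique hnext
    refine ⟨x, ⟨⟨⟨?_, ?_, hxQ⟩, by rwa [hxd]⟩, ?_⟩, ?_⟩
    · rw [← Rat.num_pos, hxn]
      omega
    · rw [← Rat.num_le_denom_iff, hxn, hxd]
      exact h2.le
    · rw [denPoint, hxy, hxd, hyd]
      exact hab
    · simp only [hxy, hxd, hyd]

lemma denPoint_mem_region_iff {r Q : ℕ} (hr : 1 ≤ r) {x : ℚ} (hx : x.den ≤ Q) (he : Even x.den)
    (x₀ y₀ η : ℝ) : denPoint Q x ∈ region r x₀ y₀ η ↔ ParityChain r Q x ∧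
      ((x.den : ℝ) / (Q : ℝ), (((next Q)^[r + 1] x).den : ℝ) / (Q : ℝ)) ∈ square x₀ y₀ η := by
  rw [parityChain_iff hr hx he, ← denPoint_mem_parallelogram_iff hr hx]
  simp only [region, Set.mem_iUnion, Set.mem_ofPred_eq, exists_prop]
  constructor
  · rintro ⟨k, hk, hp, hq⟩
    obtain rfl : k = quotients r Q x := by
      by_contra hne
      exact Set.disjoint_left.mp (polygon_disjoint hne) hp (denPoint_mem_polygon hx r)
    exact ⟨hk, hq⟩
  · rintro ⟨hk, hq⟩
    exact ⟨_, hk, denPoint_mem_polygon hx r, hq⟩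

/-- Any element of B that starts no pair is maximal in B, so there is at most one. -/
lemma ncard_le_of_injOn_fst {A : Set (ℚ × ℚ)} {B : Set ℚ} (hB : B.Finite)
    (hinj : Set.InjOn Prod.fst A) (hmaps : ∀ p ∈ A, p.1 ∈ B)
    (hmax : ∀ x ∈ B, x ∉ Prod.fst '' A → ∀ y ∈ B, y ≤ x) :
    A.ncard ≤ B.ncard ∧ B.ncard ≤ A.ncard + 1 := by
  have hsub : Prod.fst '' A ⊆ B := by
    rintro _ ⟨p, hp, rfl⟩
    exact hmaps p hp
  rw [← hinj.ncard_image]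
  refine ⟨Set.ncard_le_ncard hsub hB, ?_⟩
  rw [← Set.ncard_sdiff_add_ncard_of_subset hsub hB, add_comm]
  gcongr
  rw [Set.ncard_le_one_iff (hB.subset Set.sdiff_subset)]
  intro x y hx hy
  exact le_antisymm (hmax y hy.1 hy.2 x hx.1) (hmax x hx.1 hx.2 y hy.1)

lemma evenPairs_injOn_fst (Q : ℕ) : Set.InjOn Prod.fst (evenPairs Q) := by
  rintro ⟨x, y⟩ ⟨h1, h2, h3, h4⟩ ⟨x', z⟩ ⟨g1, g2, g3, g4⟩ (rfl : x = x')
  simp only at *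
  rcases lt_trichotomy y z with h | h | h
  · exact absurd ⟨h3, h⟩ (g4 y h2)
  · rw [h]
  · exact absurd ⟨g3, h⟩ (h4 z g2)

lemma ncard_evenPairs_bounds {Q : ℕ} (hQ : 0 < Q) :
    (evenPairs Q).ncard ≤ (evenCoprimePoints triangle Q).ncard ∧
      (evenCoprimePoints triangle Q).ncard ≤ (evenPairs Q).ncard + 1 := by
  rw [← ncard_fareyEven_inter le_rfl hQ]
  have : {x | x ∈ fareyEven Q ∧ denPoint Q x ∈ triangle} = fareyEven Q :=
    Set.ext fun x => ⟨fun h => h.1, fun h => ⟨h, denPoint_mem_triangle h.1.2.2⟩⟩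
  rw [this]
  refine ncard_le_of_injOn_fst (finite_fareyEven Q) (evenPairs_injOn_fst Q) (fun p hp => hp.1) ?_
  intro x hx hnot y hy
  by_contra! hlt
  obtain ⟨z, ⟨hz, hxz⟩, hmin⟩ := Set.exists_min_image {z | z ∈ fareyEven Q ∧ x < z} id
    ((finite_fareyEven Q).subset fun _ h => h.1) ⟨y, hy, hlt⟩
  exact hnot ⟨(x, z), ⟨hx, hz, hxz, fun w hw hxw =>
    absurd (hmin w ⟨hw, hxw.1⟩) (not_le.mpr hxw.2)⟩, rfl⟩

/-- Between consecutive even fractions all fractions are odd, so a pair of type T(r) is a chain of r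
+ 1 successor steps with the required parities. Such a chain from a Farey fraction fails to give a
pair only if it ends beyond 1. -/
lemma ncard_pairsOfType_bounds {r : ℕ} (hr : 1 ≤ r) (x₀ y₀ η : ℝ) {Q : ℕ} (hQ : 0 < Q) :
    {p | p ∈ pairsOfType r Q ∧
      ((p.1.den : ℝ) / (Q : ℝ), (p.2.den : ℝ) / (Q : ℝ)) ∈ square x₀ y₀ η}.ncard ≤
        (evenCoprimePoints (region r x₀ y₀ η) Q).ncard ∧
    (evenCoprimePoints (region r x₀ y₀ η) Q).ncard ≤ {p | p ∈ pairsOfType r Q ∧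
      ((p.1.den : ℝ) / (Q : ℝ), (p.2.den : ℝ) / (Q : ℝ)) ∈ square x₀ y₀ η}.ncard + 1 := by
  rw [← ncard_fareyEven_inter (region_subset_triangle hr x₀ y₀ η) hQ]
  refine ncard_le_of_injOn_fst ((finite_fareyEven Q).subset fun _ h => h.1)
    ((evenPairs_injOn_fst Q).mono fun p hp => hp.1.1) ?_ ?_
  · rintro ⟨x, z⟩ ⟨⟨⟨hx, hz, hxz, hcons⟩, hcard⟩, hsq⟩
    simp only at hx hz hxz hcons hcard hsq
    refine ⟨hx, ?_⟩
    have hxQ := hx.1.2.2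
    rw [denPoint_mem_region_iff hr hxQ hx.2]
    have hodd : ∀ y ∈ between Q x z, y ∈ farey Q ∧ Odd y.den := by
      intro y hy
      have hf : y ∈ farey Q := ⟨hx.1.1.trans hy.2.1, hy.2.2.le.trans hz.1.2.1, hy.1⟩
      refine ⟨hf, Nat.not_even_iff_odd.mp fun he => ?_⟩
      exact hcons y ⟨hf, he⟩ hy.2
    have hset : {y | y ∈ farey Q ∧ Odd y.den ∧ x < y ∧ y < z} = between Q x z :=
      Set.ext fun y => ⟨fun h => ⟨h.1.2.2, h.2.2⟩,
        fun h => ⟨(hodd y h).1, (hodd y h).2, h.2⟩⟩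
    rw [hset] at hcard
    obtain ⟨h1, h2⟩ := iterate_of_ncard_between hxQ hz.1.2.2 hxz hcard
    rw [ParityChain, h1]
    exact ⟨⟨fun j hj => (hodd _ (h2 j hj)).2, hz.2⟩, hsq⟩
  · rintro x ⟨hx, hreg⟩ hnot y ⟨hy, -⟩
    have hxQ := hx.1.2.2
    rw [denPoint_mem_region_iff hr hxQ hx.2] at hreg
    obtain ⟨⟨hodd, heven⟩, hsq⟩ := hreg
    set z := (next Q)^[r + 1] x with hz
    have hxz : x < z := lt_iterate hxQ r
    obtain ⟨hcard, hmem⟩ := between_iterate hxQ r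
    rw [← hz] at hcard hmem
    have hodd' : ∀ w ∈ between Q x z, Odd w.den := by
      intro w hw
      obtain ⟨j, hj, rfl⟩ := hmem w hw
      exact hodd j hj
    -- If z > 1, every Farey fraction after x lies inside the chain and is odd, so x is the largest
    -- even fraction.
    rcases le_or_gt z 1 with hz1 | hz1
    · refine absurd ⟨(x, z), ⟨⟨⟨hx, ⟨⟨hx.1.1.trans hxz, hz1, den_iterate_le hxQ _⟩, heven⟩, hxz,
        fun w hw hw' => ?_⟩, ?_⟩, hsq⟩, rfl⟩ hnot
      · exact Nat.not_even_iff_odd.mpr (hodd' w ⟨hw.1.2.2, hw'⟩) hw.2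
      · have hset : {y | y ∈ farey Q ∧ Odd y.den ∧ x < y ∧ y < z} = between Q x z :=
          Set.ext fun y => ⟨fun h => ⟨h.1.2.2, h.2.2⟩, fun h =>
            ⟨⟨hx.1.1.trans h.2.1, h.2.2.le.trans hz1, h.1⟩, hodd' y h, h.2⟩⟩
        exact (congrArg Set.ncard hset).trans hcard
    · by_contra! hlt
      exact Nat.not_even_iff_odd.mpr (hodd' y ⟨hy.1.2.2, hlt, hy.1.2.1.trans_lt hz1⟩) hy.2

lemma tendsto_of_bounds {a b : ℕ → ℕ} {c : ℝ} (h : ∀ Q > 0, a Q ≤ b Q ∧ b Q ≤ a Q + 1)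
    (hb : Tendsto (fun Q : ℕ => (b Q : ℝ) / (Q : ℝ) ^ 2) atTop (𝓝 c)) :
    Tendsto (fun Q : ℕ => (a Q : ℝ) / (Q : ℝ) ^ 2) atTop (𝓝 c) := by
  have h1 : Tendsto (fun Q : ℕ => (b Q : ℝ) / (Q : ℝ) ^ 2 - 1 / (Q : ℝ) ^ 2) atTop (𝓝 (c - 0)) := by
    refine hb.sub ?_
    simp only [one_div]
    exact tendsto_inv_atTop_zero.comp
      ((tendsto_pow_atTop two_ne_zero).comp tendsto_natCast_atTop_atTop)
  rw [sub_zero] at h1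
  refine tendsto_of_tendsto_of_tendsto_of_le_of_le' h1 hb ?_ ?_
  · filter_upwards [eventually_gt_atTop 0] with Q hQ
    rw [← sub_div]
    gcongr
    have : (b Q : ℝ) ≤ a Q + 1 := by exact_mod_cast (h Q hQ).2
    linarith
  · filter_upwards [eventually_gt_atTop 0] with Q hQ
    gcongr
    exact (h Q hQ).1

/-- Both counts are asymptotic to the same constant times an area times Q²; the factor 2 is the
reciprocal of the area of the triangle. -/
lemma tendsto_proportion {r : ℕ} (hr : 1 ≤ r) {x₀ y₀ η : ℝ}
    (hf : volume (frontier (region r x₀ y₀ η)) = 0) :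
    Tendsto (proportion r x₀ y₀ η) atTop (𝓝 (2 * volume.real (region r x₀ y₀ η))) := by
  have h1 := tendsto_of_bounds (fun Q hQ => ncard_pairsOfType_bounds hr x₀ y₀ η hQ)
    (tendsto_evenCoprimePoints ((region_subset_triangle hr x₀ y₀ η).trans triangle_subset_Ioc)
      (measurableSet_region hr x₀ y₀ η) hf)
  have h2 := tendsto_of_bounds (fun Q hQ => ncard_evenPairs_bounds hQ)
    (tendsto_evenCoprimePoints triangle_subset_Ioc measurableSet_triangle
      (Convex.addHaar_frontier volume convex_triangle))
  have hvol : volume.real triangle = 1 / 2 := by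
    rw [Measure.real, volume_triangle, ENNReal.toReal_ofReal (by norm_num)]
  rw [hvol] at h2
  have hc := evenCoprimeDensity_ne_zero
  have h3 := h1.div h2 (by positivity)
  have e : evenCoprimeDensity * volume.real (region r x₀ y₀ η) / (evenCoprimeDensity * (1 / 2)) =
      2 * volume.real (region r x₀ y₀ η) := by
    field_simp
  rw [e] at h3
  refine h3.congr' ?_
  filter_upwards [eventually_gt_atTop 0] with Q hQ
  have hQ' : (0 : ℝ) < Q := by exact_mod_cast hQ
  exact div_div_div_cancel_right₀ (by positivity) _ _

/-! ### The limit of the density as the square shrinks -/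

lemma volume_region_ne_top {r : ℕ} (hr : 1 ≤ r) (x₀ y₀ η : ℝ) :
    volume (region r x₀ y₀ η) ≠ ∞ :=
  ne_top_of_le_ne_top (by rw [volume_triangle]; exact ENNReal.ofReal_ne_top)
    (measure_mono (region_subset_triangle hr x₀ y₀ η))

/-- The area of `T_k ∩ P_k(η)` for admissible `k`, normalized by `2 η ^ 2`. -/
def normalizedArea (r : ℕ) (x₀ y₀ η : ℝ) (k : Fin r → ℕ) : ℝ≥0∞ :=
  {k | Admissible k}.indicator
    (fun k => volume (polygon k ∩ parallelogram k x₀ y₀ η) / ENNReal.ofReal (2 * η ^ 2)) k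

lemma ofReal_eq_tsum {r : ℕ} (hr : 1 ≤ r) (x₀ y₀ : ℝ) {η : ℝ} (hη : 0 < η) :
    ENNReal.ofReal (2 * volume.real (region r x₀ y₀ η) / (4 * η ^ 2)) =
      ∑' k : Fin r → ℕ, normalizedArea r x₀ y₀ η k := by
  rw [show 2 * volume.real (region r x₀ y₀ η) / (4 * η ^ 2) =
      volume.real (region r x₀ y₀ η) / (2 * η ^ 2) by field_simp; ring,
    ENNReal.ofReal_div_of_pos (by positivity), Measure.real,
    ENNReal.ofReal_toReal (volume_region_ne_top hr x₀ y₀ η), volume_region hr, div_eq_mul_inv,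
    ← ENNReal.tsum_mul_right]
  refine tsum_congr fun k => ?_
  by_cases hk : k ∈ {k : Fin r → ℕ | Admissible k}
  · rw [normalizedArea, Set.indicator_of_mem hk, Set.indicator_of_mem hk, div_eq_mul_inv]
  · rw [normalizedArea, Set.indicator_of_notMem hk, Set.indicator_of_notMem hk, zero_mul]

lemma eventually_normalizedArea_eq {r : ℕ} (hr : 1 ≤ r) (x₀ y₀ : ℝ) (k : Fin r → ℕ) :
    ∀ᶠ η in 𝓝[>] (0 : ℝ), normalizedArea r x₀ y₀ η k =
      {k | Admissible k}.indicator (fun k => localArea k x₀ y₀ / 2) k := by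
  filter_upwards [eventually_volume_eq hr k x₀ y₀, self_mem_nhdsWithin] with η h1 h2
  have h2 : 0 < η := h2
  by_cases hk : k ∈ {k : Fin r → ℕ | Admissible k}
  · have h3 : ENNReal.ofReal (η ^ 2) ≠ 0 := by simpa using h2.ne'
    rw [normalizedArea, Set.indicator_of_mem hk, Set.indicator_of_mem hk, h1,
      mul_comm 2 (η ^ 2), ENNReal.ofReal_mul (sq_nonneg η), ENNReal.ofReal_ofNat,
      ENNReal.mul_div_mul_left _ _ h3 ENNReal.ofReal_ne_top]
  · rw [normalizedArea, Set.indicator_of_notMem hk, Set.indicator_of_notMem hk]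

/-- In the finite case only tuples bounded by a fixed N contribute, and each term is eventually
constant. At the corner with r = 1 the limit is ∞, and finite partial sums, again eventually
constant, exceed any bound. -/
lemma tendsto_tsum_normalizedArea {r : ℕ} (hr : 1 ≤ r) {x₀ y₀ : ℝ} (hx : x₀ ≤ 1) (hy : y₀ ≤ 1)
    (h : ((x₀, y₀) ≠ ((1 : ℝ), (1 : ℝ)) ∨ 4 ≤ r) ∨ r = 1) :
    Tendsto (fun η => ∑' k : Fin r → ℕ, normalizedArea r x₀ y₀ η k) (𝓝[>] (0 : ℝ))
      (𝓝 (densityFormula r x₀ y₀)) := by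
  by_cases h' : (x₀, y₀) ≠ ((1 : ℝ), (1 : ℝ)) ∨ 4 ≤ r
  · rw [densityFormula_eq hr]
    obtain ⟨N, η₀, hη₀, hN⟩ := exists_bound_of_nonempty hr hx hy h'
    have hfin := finite_setOf_le (r := r) N
    have hzero : ∀ k ∉ hfin.toFinset, ∀ η ≤ η₀, normalizedArea r x₀ y₀ η k = 0 := by
      intro k hk η hη
      rw [Set.Finite.mem_toFinset] at hk
      by_cases hA : k ∈ {k : Fin r → ℕ | Admissible k}
      · have : polygon k ∩ parallelogram k x₀ y₀ η = ∅ := by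
          by_contra hne
          obtain ⟨v, hv⟩ := Set.nonempty_iff_ne_empty.mpr hne
          exact hk (hN k hA ⟨v, hv.1, parallelogram_mono k x₀ y₀ hη hv.2⟩)
        rw [normalizedArea, Set.indicator_of_mem hA, this, measure_empty, ENNReal.zero_div]
      · rw [normalizedArea, Set.indicator_of_notMem hA]
    have hall : ∀ᶠ η in 𝓝[>] (0 : ℝ), ∀ k ∈ hfin.toFinset, normalizedArea r x₀ y₀ η k =
        {k | Admissible k}.indicator (fun k => localArea k x₀ y₀ / 2) k :=
      (Filter.eventually_all_finset _).mpr fun k _ => eventually_normalizedArea_eq hr x₀ y₀ k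
    have hle : ∀ᶠ η in 𝓝[>] (0 : ℝ), η ≤ η₀ := nhdsWithin_le_nhds (Iic_mem_nhds hη₀)
    refine tendsto_const_nhds.congr' ?_
    filter_upwards [hall, hle] with η h1 h2
    refine tsum_congr fun k => ?_
    by_cases hk : k ∈ hfin.toFinset
    · exact (h1 k hk).symm
    -- A tuple outside the finite set has zero area for every η ≤ η₀, so evaluating at one suitable
    -- η' shows that its limit term is zero as well.
    · obtain ⟨η', g1, g2⟩ := ((eventually_normalizedArea_eq hr x₀ y₀ k).and hle).exists
      rw [hzero k hk η h2, ← g1, hzero k hk η' g2]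
  · obtain rfl : r = 1 := h.resolve_left h'
    push Not at h'
    obtain ⟨rfl, rfl⟩ := Prod.ext_iff.mp h'.1
    simp only
    rw [densityFormula_one_corner, ENNReal.tendsto_nhds_top_iff_nnreal]
    intro B
    have hsum : (B : ℝ≥0∞) < ∑' k : Fin 1 → ℕ,
        {k | Admissible k}.indicator (fun k => localArea k 1 1 / 2) k := by
      rw [← densityFormula_eq le_rfl, densityFormula_one_corner]
      exact ENNReal.coe_lt_top
    rw [ENNReal.tsum_eq_iSup_sum, lt_iSup_iff] at hsum
    obtain ⟨F, hF⟩ := hsum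
    have hall : ∀ᶠ η in 𝓝[>] (0 : ℝ), ∀ k ∈ F, normalizedArea 1 1 1 η k =
        {k | Admissible k}.indicator (fun k => localArea k 1 1 / 2) k :=
      (Filter.eventually_all_finset _).mpr fun k _ => eventually_normalizedArea_eq le_rfl 1 1 k
    filter_upwards [hall] with η hη
    refine hF.trans_le ?_
    rw [← Finset.sum_congr rfl hη]
    exact ENNReal.sum_le_tsum F

lemma hasLocalDensity {r : ℕ} (hr : 1 ≤ r) {x₀ y₀ : ℝ} (hx : x₀ ≤ 1) (hy : y₀ ≤ 1)
    (h : ((x₀, y₀) ≠ ((1 : ℝ), (1 : ℝ)) ∨ 4 ≤ r) ∨ r = 1) :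
    HasLocalDensity r x₀ y₀ (densityFormula r x₀ y₀) := by
  refine ⟨fun η => 2 * volume.real (region r x₀ y₀ η), ?_, ?_⟩
  · filter_upwards [eventually_volume_frontier_region hr hx hy h] with η hη
    exact tendsto_proportion hr hη
  · refine (tendsto_tsum_normalizedArea hr hx hy h).congr' ?_
    filter_upwards [self_mem_nhdsWithin] with η hη
    exact (ofReal_eq_tsum hr x₀ y₀ hη).symm

end EvenFarey

end

theorem theorem3 (r : ℕ) (hr : 1 ≤ r) (x₀ y₀ : ℝ)
    (hx : x₀ ∈ Set.Icc (0 : ℝ) 1) (hy : y₀ ∈ Set.Icc (0 : ℝ) 1)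
    (hcorner : (x₀, y₀) = ((1 : ℝ), (1 : ℝ)) → r ≠ 2 ∧ r ≠ 3) :
    EvenFarey.HasLocalDensity r x₀ y₀ (EvenFarey.densityFormula r x₀ y₀) ∧
    (∀ k ∈ EvenFarey.vertexTuples r x₀ y₀, ∀ᶠ η in nhdsWithin (0 : ℝ) (Set.Ioi 0),
      EvenFarey.overlapArea k x₀ y₀ η = EvenFarey.alpha k x₀ y₀ * η ^ 2) ∧
    ((x₀, y₀) ≠ ((1 : ℝ), (1 : ℝ)) →
      (EvenFarey.interiorTuples r x₀ y₀ ∪ EvenFarey.edgeTuples r x₀ y₀ ∪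
        EvenFarey.vertexTuples r x₀ y₀).Finite) := by
  refine ⟨EvenFarey.hasLocalDensity hr hx.2 hy.2 ?_, fun k _ => ?_, fun hne => ?_⟩
  -- At the corner, r ≥ 4 belongs to the finite case and r = 1 to the divergent one.
  · by_cases h : (x₀, y₀) = ((1 : ℝ), (1 : ℝ))
    · have := hcorner h
      by_cases h1 : r = 1
      · exact Or.inr h1
      · exact Or.inl (Or.inr (by omega))
    · exact Or.inl (Or.inl h)
  · rw [EvenFarey.alpha_eq hr]
    exact EvenFarey.eventually_overlapArea_eq hr k x₀ y₀
  · refine (EvenFarey.finite_center_mem_closure hr hx.2 hy.2 (Or.inl hne)).subset ?_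
    rintro k ((⟨hk, hC⟩ | ⟨hk, hC, -⟩) | ⟨hk, hC⟩)
    · exact ⟨hk, subset_closure (interior_subset hC)⟩
    · exact ⟨hk, hC.1⟩
    · exact ⟨hk, hC.1⟩
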